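/- Let $0<\beta<1$. Let $M_\beta(z)=\sum_{n=0}^\infty \frac{(-z)^n}{n!\,\Gamma(-\beta n+1-\beta)}$ ($z\in\mathbb{C}$, with $1/\Gamma=0$ at the poles of $\Gamma$) be the $M$-Wright function and $E_\beta(z)=\sum_{n=0}^\infty \frac{z^n}{\Gamma(\beta n+1)}$ the Mittag-Leffler function. For $\rho\ge \tfrac12$ and $z\in\mathbb{C}\setminus\{0\}$ let $$H^{1\,1}_{1\,2}\left(z\,\middle|\,\begin{matrix}(1-\rho,1)\\(0,1),(\beta(1-\rho),\beta)\end{matrix}\right)=\frac1{2\pi i}\int_{\mathcal L}\frac{\Gamma(s)\,\Gamma(\rho-s)}{\Gamma(1-\beta(1-\rho)-\beta s)}\,z^{-s}\,ds$$ be the Fox $H$-function, where $\mathcal L$ is a loop that begins at $-\infty+i\varphi_1$, ends at $-\infty+i\varphi_2$ with $\varphi_1<0<\varphi_2$, and encircles all the poles of $\Gamma(s)$ once in the positive direction but none of the poles of $\Gamma(\rho-s)$; at $z=0$ the function is defined by holomorphic extension. Then for all $\rho\ge\tfrac12$ and all $z\in\mathbb{C}$ the integral below converges absolutely and $$\int_0^\infty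 M_\beta(r)\,r^{\rho-1}e^{-rz}\,dr = H^{1\,1}_{1\,2}\left(z\,\middle|\,\begin{matrix}(1-\rho,1)\\(0,1),(\beta(1-\rho),\beta)\end{matrix}\right)=\sum_{k=0}^\infty\frac{(-z)^k\,\Gamma(\rho+k)}{k!\,\Gamma(1-\beta+\beta\rho+\beta k)}.$$ In particular, for all $z\in\mathbb{C}$, $$\int_0^\infty M_\beta(r)\,e^{-rz}\,dr=E_\beta(-z).$$ -/

import Mathlib

open scoped Topology

/-- The Mittag-Leffler function `E_β(z) = ∑ zⁿ / Γ(β n + 1)`. -/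
noncomputable def mittagLeffler (β : ℝ) (z : ℂ) : ℂ :=
  ∑' n : ℕ, z ^ n / Complex.Gamma ((β : ℂ) * n + 1)

/-- The `M`-Wright function `M_β(z) = ∑ (-z)ⁿ / (n! Γ(-β n + 1 - β))`.
At a pole of `Γ` the summand is `0`, as it should be, because `Complex.Gamma` is `0` there
and division by `0` gives `0`. -/
noncomputable def mWright (β : ℝ) (z : ℂ) : ℂ :=
  ∑' n : ℕ, (-z) ^ n / ((n.factorial : ℂ) * Complex.Gamma (-(β : ℂ) * n + 1 - β))

/-- The parameters `(a₁,A₁),…,(a_p,A_p)` and `(b₁,B₁),…,(b_q,B_q)` of a Fox function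
`H^{m n}_{p q}`. -/
structure FoxParams (m n p q : ℕ) where
  a : Fin p → ℂ
  A : Fin p → ℝ
  b : Fin q → ℂ
  B : Fin q → ℝ

namespace FoxParams

variable {m n p q : ℕ}

/-- The standing conditions on the parameters, in the case `∑ A < ∑ B`, in which the contour of
the Fox function is a loop that begins and ends at `-∞`. -/
def Valid (P : FoxParams m n p q) : Prop :=
  n ≤ p ∧ 1 ≤ m ∧ m ≤ q ∧ (∀ j, 0 < P.A j) ∧ (∀ j, 0 < P.B j) ∧ ∑ j, P.A j < ∑ j, P.B j

/-- The Mellin-Barnes kernel `Θ(s)`. -/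
noncomputable def theta (P : FoxParams m n p q) (s : ℂ) : ℂ :=
  ((∏ j ∈ Finset.univ.filter (fun j : Fin q => (j : ℕ) < m), Complex.Gamma (P.b j + s * P.B j)) *
      ∏ j ∈ Finset.univ.filter (fun j : Fin p => (j : ℕ) < n), Complex.Gamma (1 - P.a j - s * P.A j)) /
    ((∏ j ∈ Finset.univ.filter (fun j : Fin q => m ≤ (j : ℕ)), Complex.Gamma (1 - P.b j - s * P.B j)) *
      ∏ j ∈ Finset.univ.filter (fun j : Fin p => n ≤ (j : ℕ)), Complex.Gamma (P.a j + s * P.A j))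

/-- The integrand `Θ(s) z^{-s}`, with the principal branch of the power. -/
noncomputable def integrand (P : FoxParams m n p q) (z s : ℂ) : ℂ :=
  P.theta s * z ^ (-s)

/-- The loop `-∞ + iφ₁ → γ + iφ₁ → γ + iφ₂ → -∞ + iφ₂` encircles, in the positive direction, all
the poles of `Γ(b_j + s B_j)`, `j ≤ m`, and none of the poles of `Γ(1 - a_j - s A_j)`, `j ≤ n`
(and it passes through none of them). -/
def IsLoop (P : FoxParams m n p q) (γ φ₁ φ₂ : ℝ) : Prop :=
  φ₁ < φ₂ ∧
  (∀ j : Fin q, (j : ℕ) < m → ∀ (k : ℕ) (s : ℂ), P.b j + s * P.B j = -(k : ℂ) →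
    s.re < γ ∧ φ₁ < s.im ∧ s.im < φ₂) ∧
  (∀ j : Fin p, (j : ℕ) < n → ∀ (k : ℕ) (s : ℂ), 1 - P.a j - s * P.A j = -(k : ℂ) →
    ¬ (s.re ≤ γ ∧ φ₁ ≤ s.im ∧ s.im ≤ φ₂))

/-- The integral over the loop converges absolutely. -/
def LoopIntegrable (P : FoxParams m n p q) (z : ℂ) (γ φ₁ φ₂ : ℝ) : Prop :=
  MeasureTheory.IntegrableOn
    (fun x : ℝ => P.integrand z ((x : ℂ) + φ₁ * Complex.I)) (Set.Iic γ) ∧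
  IntervalIntegrable
    (fun y : ℝ => P.integrand z ((γ : ℂ) + y * Complex.I)) MeasureTheory.volume φ₁ φ₂ ∧
  MeasureTheory.IntegrableOn
    (fun x : ℝ => P.integrand z ((x : ℂ) + φ₂ * Complex.I)) (Set.Iic γ)

/-- `(1 / 2πi) ∫ Θ(s) z^{-s} ds` over the loop. -/
noncomputable def loopIntegral (P : FoxParams m n p q) (z : ℂ) (γ φ₁ φ₂ : ℝ) : ℂ :=
  (1 / (2 * (Real.pi : ℂ) * Complex.I)) *
    ((∫ x in Set.Iic γ, P.integrand z ((x : ℂ) + φ₁ * Complex.I)) +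
      Complex.I * (∫ y in φ₁..φ₂, P.integrand z ((γ : ℂ) + y * Complex.I)) -
      ∫ x in Set.Iic γ, P.integrand z ((x : ℂ) + φ₂ * Complex.I))

/-- The Mellin-Barnes integral at `z` is `w`: an admissible loop exists, and over every admissible
loop the integral converges absolutely and has the value `w`. -/
def HasContourValue (P : FoxParams m n p q) (z w : ℂ) : Prop :=
  (∃ γ φ₁ φ₂ : ℝ, P.IsLoop γ φ₁ φ₂) ∧
  ∀ γ φ₁ φ₂ : ℝ, P.IsLoop γ φ₁ φ₂ →
    P.LoopIntegrable z γ φ₁ φ₂ ∧ P.loopIntegral z γ φ₁ φ₂ = w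

/-- The Fox function is defined at `z` and has the value `w` there: for `z ≠ 0` through the
Mellin-Barnes integral, at `z = 0` through the holomorphic extension. -/
def HasFoxH (P : FoxParams m n p q) (z w : ℂ) : Prop :=
  P.Valid ∧
  ((z ≠ 0 ∧ P.HasContourValue z w) ∨
    (z = 0 ∧ ∃ h : ℂ → ℂ, AnalyticAt ℂ h 0 ∧ h 0 = w ∧
      ∀ᶠ u in 𝓝[≠] (0 : ℂ), P.HasContourValue u (h u)))

open Classical in
/-- The Fox function `H^{m n}_{p q}`, with the value `0` where it is not defined. -/
noncomputable def foxH (P : FoxParams m n p q) (z : ℂ) : ℂ :=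
  if h : ∃ w, P.HasFoxH z w then h.choose else 0

theorem HasContourValue.unique {P : FoxParams m n p q} {z w w' : ℂ}
    (h : P.HasContourValue z w) (h' : P.HasContourValue z w') : w = w' := by
  obtain ⟨⟨γ, φ₁, φ₂, hL⟩, h⟩ := h
  rw [← (h γ φ₁ φ₂ hL).2, ← (h'.2 γ φ₁ φ₂ hL).2]

theorem HasFoxH.unique {P : FoxParams m n p q} {z w w' : ℂ}
    (h : P.HasFoxH z w) (h' : P.HasFoxH z w') : w = w' := by
  rcases h with ⟨-, ⟨hz, h⟩ | ⟨hz, f, hf, rfl, h⟩⟩ <;>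
    rcases h' with ⟨-, ⟨hz', h'⟩ | ⟨hz', g, hg, rfl, h'⟩⟩
  · exact h.unique h'
  · exact absurd hz' hz
  · exact absurd hz hz'
  · have e : f =ᶠ[𝓝[≠] (0 : ℂ)] g := by
      filter_upwards [h, h'] with u hu hu'
      exact hu.unique hu'
    have hf' := hf.continuousAt.tendsto.mono_left (nhdsWithin_le_nhds (s := {0}ᶜ))
    have hg' := hg.continuousAt.tendsto.mono_left (nhdsWithin_le_nhds (s := {0}ᶜ))
    exact tendsto_nhds_unique (hf'.congr' e) hg'

theorem HasFoxH.foxH_eq {P : FoxParams m n p q} {z w : ℂ} (h : P.HasFoxH z w) :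
    P.foxH z = w := by
  have h' : ∃ w, P.HasFoxH z w := ⟨w, h⟩
  rw [foxH, dif_pos h']
  exact h'.choose_spec.unique h

end FoxParams

/-- The parameters of `H^{1 1}_{1 2}( · | (1-ρ,1) ; (0,1), (β(1-ρ),β))`. -/
noncomputable def laplaceFoxParams (β ρ : ℝ) : FoxParams 1 1 1 2 where
  a := ![1 - (ρ : ℂ)]
  A := ![1]
  b := ![0, (β : ℂ) * (1 - ρ)]
  B := ![1, β]

/-! The Laplace transform and the Fox function are evaluated separately, and both equal the series
with terms `laplaceFoxTerm`.

Fox side. The integrand has simple poles at s = -k, and its residue there is the k-th term. By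
reflection, Γ(s) Γ(ρ - s) is π / sin(πs) times Γ(ρ - s) / Γ(1 - s), a quotient that grows at most
exponentially as Re s → -∞. The factor 1 / Γ(1 - β + βρ - βs) decays faster than every exponential
because β > 0. The loop can therefore be closed by the lines Re s = -n - 1/2, whose contribution
vanishes in the limit (`laplaceFoxParams_hasContourValue`).

Laplace side. Expanding exp(-rz) and integrating term by term requires that M_β decay faster than
every exponential (`exists_norm_mWright_le`) and that its moments be Γ(s) / Γ(1 - β + βs)
(`integral_rpow_mul_mWright`). Both follow from M_β(r) = (1/π) Im ∫₀^∞ exp(x e^{iθ} - r x^β e^{iβθ})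
x^{β-1} e^{iβθ} dx, π/2 < θ < π, which is Hankel's contour folded onto one ray by conjugation
(`mWright_eq_integral`). As β < 1, θ can be chosen with βθ < π/2, and then both exponentials decay.
For the moments, Fubini's theorem covers 0 < s < 1 and the identity theorem the remaining s > 0. The
termwise integration also supplies the convergence of the residue series that the Fox side needs. -/

/-! ### Rectangles, residues and half-infinite strips -/

/-- The integral of `f` over the positively oriented boundary of `[a, b] × [c, d]`. -/
noncomputable def rectBoundaryIntegral (f : ℂ → ℂ) (a b c d : ℝ) : ℂ :=
  (∫ x in a..b, f (x + c * Complex.I)) - (∫ x in a..b, f (x + d * Complex.I)) +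
    Complex.I * (∫ y in c..d, f (b + y * Complex.I)) -
    Complex.I * (∫ y in c..d, f (a + y * Complex.I))

theorem rectBoundaryIntegral_eq_zero {f : ℂ → ℂ} {a b c d : ℝ}
    (hf : DifferentiableOn ℂ f (Set.uIcc a b ×ℂ Set.uIcc c d)) :
    rectBoundaryIntegral f a b c d = 0 := by
  have h := Complex.integral_boundary_rect_eq_zero_of_differentiableOn f
    (a + c * Complex.I) (b + d * Complex.I) (by simpa using hf)
  simpa [rectBoundaryIntegral] using h

theorem Complex.log_neg_of_im_pos {z : ℂ} (hz : 0 < z.im) :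
    Complex.log (-z) = Complex.log z - Real.pi * Complex.I := by
  apply Complex.ext <;> simp [Complex.log_re, Complex.log_im,
    Complex.arg_neg_eq_arg_sub_pi_of_im_pos hz]

theorem Complex.log_neg_of_im_neg {z : ℂ} (hz : z.im < 0) :
    Complex.log (-z) = Complex.log z + Real.pi * Complex.I := by
  apply Complex.ext <;> simp [Complex.log_re, Complex.log_im,
    Complex.arg_neg_eq_arg_add_pi_of_im_neg hz]

theorem integral_inv_horizontal {a b y : ℝ} (hy : y ≠ 0) :
    ∫ x in a..b, ((x : ℂ) + y * Complex.I)⁻¹ =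
      Complex.log (b + y * Complex.I) - Complex.log (a + y * Complex.I) := by
  have hm : ∀ x : ℝ, (x : ℂ) + y * Complex.I ∈ Complex.slitPlane := fun x => by
    right; simpa using hy
  refine intervalIntegral.integral_eq_sub_of_hasDerivAt
    (f := fun x : ℝ => Complex.log (x + y * Complex.I)) (fun x _ => ?_) ?_
  · have h1 : HasDerivAt (fun x : ℝ => (x : ℂ) + y * Complex.I) 1 x :=
      (Complex.ofRealCLM.hasDerivAt (x := x)).add_const _
    simpa using h1.clog_real (hm x)
  · refine Continuous.intervalIntegrable ?_ _ _
    exact (by fun_prop : Continuous fun x : ℝ => (x : ℂ) + y * Complex.I).inv₀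
      fun x => Complex.slitPlane_ne_zero (hm x)

theorem integral_inv_vertical_right {c d x : ℝ} (hx : 0 < x) :
    Complex.I * ∫ y in c..d, ((x : ℂ) + y * Complex.I)⁻¹ =
      Complex.log (x + d * Complex.I) - Complex.log (x + c * Complex.I) := by
  have hm : ∀ y : ℝ, (x : ℂ) + y * Complex.I ∈ Complex.slitPlane := fun y => by
    left; simpa using hx
  rw [← intervalIntegral.integral_const_mul]
  refine intervalIntegral.integral_eq_sub_of_hasDerivAt
    (f := fun y : ℝ => Complex.log (x + y * Complex.I)) (fun y _ => ?_) ?_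
  · have h1 : HasDerivAt (fun y : ℝ => (x : ℂ) + y * Complex.I) (1 * Complex.I) y :=
      ((Complex.ofRealCLM.hasDerivAt (x := y)).mul_const _).const_add _
    simpa [div_eq_mul_inv] using h1.clog_real (hm y)
  · refine Continuous.intervalIntegrable (continuous_const.mul ?_) _ _
    exact (by fun_prop : Continuous fun y : ℝ => (x : ℂ) + y * Complex.I).inv₀
      fun y => Complex.slitPlane_ne_zero (hm y)

/-- The left side of the rectangle crosses the branch cut of the logarithm, so log(-s) serves as the
primitive of 1/s there. Its jumps against log s, of -πi above and +πi below the real axis, produce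
the 2πi in `rectBoundaryIntegral_inv`. -/
theorem integral_inv_vertical_left {c d x : ℝ} (hx : x < 0) :
    Complex.I * ∫ y in c..d, ((x : ℂ) + y * Complex.I)⁻¹ =
      Complex.log (-(x + d * Complex.I)) - Complex.log (-(x + c * Complex.I)) := by
  have hm : ∀ y : ℝ, -((x : ℂ) + y * Complex.I) ∈ Complex.slitPlane := fun y => by
    left; simpa using hx
  rw [← intervalIntegral.integral_const_mul]
  refine intervalIntegral.integral_eq_sub_of_hasDerivAt
    (f := fun y : ℝ => Complex.log (-(x + y * Complex.I))) (fun y _ => ?_) ?_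
  · have h1 : HasDerivAt (fun y : ℝ => -((x : ℂ) + y * Complex.I)) (-(1 * Complex.I)) y :=
      (((Complex.ofRealCLM.hasDerivAt (x := y)).mul_const _).const_add _).neg
    have h2 := h1.clog_real (hm y)
    rwa [one_mul, neg_div_neg_eq, div_eq_mul_inv] at h2
  · refine Continuous.intervalIntegrable (continuous_const.mul ?_) _ _
    exact (by fun_prop : Continuous fun y : ℝ => (x : ℂ) + y * Complex.I).inv₀
      fun y h => Complex.slitPlane_ne_zero (hm y) (by simp [h])

theorem rectBoundaryIntegral_inv {a b c d : ℝ} (ha : a < 0) (hb : 0 < b) (hc : c < 0)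
    (hd : 0 < d) :
    rectBoundaryIntegral (fun s => s⁻¹) a b c d = 2 * Real.pi * Complex.I := by
  rw [rectBoundaryIntegral, integral_inv_horizontal hc.ne, integral_inv_horizontal hd.ne',
    integral_inv_vertical_right hb, integral_inv_vertical_left ha,
    Complex.log_neg_of_im_pos (by simpa using hd), Complex.log_neg_of_im_neg (by simpa using hc)]
  ring

theorem rectBoundaryIntegral_inv_sub {a b c d p : ℝ} (ha : a < p) (hb : p < b) (hc : c < 0)
    (hd : 0 < d) :
    rectBoundaryIntegral (fun s => (s - p)⁻¹) a b c d = 2 * Real.pi * Complex.I := by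
  rw [← rectBoundaryIntegral_inv (sub_neg.2 ha) (sub_pos.2 hb) hc hd, rectBoundaryIntegral,
    rectBoundaryIntegral]
  have h : ∀ y : ℝ, ∫ x in a..b, ((x : ℂ) + y * Complex.I - p)⁻¹ =
      ∫ x in (a - p)..(b - p), ((x : ℂ) + y * Complex.I)⁻¹ := fun y => by
    rw [← intervalIntegral.integral_comp_sub_right
      (fun x : ℝ => ((x : ℂ) + y * Complex.I)⁻¹) p]
    refine intervalIntegral.integral_congr fun x _ => ?_
    simp only [Complex.ofReal_sub]
    congr 1; ring
  rw [h, h]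
  have h' : ∀ x : ℝ, (fun y : ℝ => ((x : ℂ) + y * Complex.I - p)⁻¹) =
      fun y : ℝ => (((x - p : ℝ) : ℂ) + y * Complex.I)⁻¹ := fun x => by
    funext y; rw [Complex.ofReal_sub]; congr 1; ring
  rw [h', h']

theorem mem_boundary_ne {a b c d p : ℝ} (ha : a < p) (hb : p < b) (hc : c < 0) (hd : 0 < d) :
    (∀ x : ℝ, (x : ℂ) + c * Complex.I ≠ p) ∧ (∀ x : ℝ, (x : ℂ) + d * Complex.I ≠ p) ∧
    (∀ y : ℝ, (b : ℂ) + y * Complex.I ≠ p) ∧ (∀ y : ℝ, (a : ℂ) + y * Complex.I ≠ p) := by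
  refine ⟨fun x h => hc.ne ?_, fun x h => hd.ne' ?_, fun y h => hb.ne' ?_, fun y h => ha.ne ?_⟩
  · simpa using congrArg Complex.im h
  · simpa using congrArg Complex.im h
  · simpa using congrArg Complex.re h
  · simpa using congrArg Complex.re h

/-- The residue theorem for a rectangle and one simple pole on the real axis. -/
theorem rectBoundaryIntegral_of_simplePole {f : ℂ → ℂ} {a b c d p : ℝ} {w : ℂ}
    (ha : a < p) (hb : p < b) (hc : c < 0) (hd : 0 < d)
    (hf : DifferentiableOn ℂ f ((Set.Icc a b ×ℂ Set.Icc c d) \ {(p : ℂ)}))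
    (hw : Filter.Tendsto (fun s => (s - p) * f s) (𝓝[≠] (p : ℂ)) (𝓝 w)) :
    rectBoundaryIntegral f a b c d = 2 * Real.pi * Complex.I * w := by
  set R : Set ℂ := Set.Icc a b ×ℂ Set.Icc c d with hR
  have hab : a ≤ b := (ha.trans hb).le
  have hcd : c ≤ d := (hc.trans hd).le
  have hRp : R ∈ 𝓝 (p : ℂ) := by
    rw [hR]
    refine Filter.mem_of_superset ((isOpen_Ioo.reProdIm isOpen_Ioo).mem_nhds
      (?_ : (p : ℂ) ∈ Set.Ioo a b ×ℂ Set.Ioo c d)) ?_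
    · simp [Complex.mem_reProdIm, ha, hb, hc, hd]
    · exact fun z hz => ⟨Set.Ioo_subset_Icc_self hz.1, Set.Ioo_subset_Icc_self hz.2⟩
  -- With the value w filled in at p, (s - p) f(s) becomes holomorphic on R. Hence f is w / (s - p)
  -- plus the slope of F at p, which is holomorphic on R and contributes nothing.
  set F : ℂ → ℂ := Function.update (fun s => (s - p) * f s) (p : ℂ) w with hF
  have hFd : DifferentiableOn ℂ F R := by
    rw [← Complex.differentiableOn_compl_singleton_and_continuousAt_iff hRp]
    constructor
    · have : DifferentiableOn ℂ (fun s => (s - p) * f s) (R \ {(p : ℂ)}) :=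
        (by fun_prop : DifferentiableOn ℂ (fun s : ℂ => s - p) _).mul hf
      refine this.congr fun s hs => ?_
      rw [hF, Function.update_of_ne hs.2]
    · rw [hF, continuousAt_update_same]; exact hw
  have hD : DifferentiableOn ℂ (dslope F p) R := (Complex.differentiableOn_dslope hRp).2 hFd
  have h0 := rectBoundaryIntegral_eq_zero (f := dslope F p) (a := a) (b := b) (c := c) (d := d)
    (by rwa [Set.uIcc_of_le hab, Set.uIcc_of_le hcd])
  have hfe : ∀ s : ℂ, s ≠ p → f s = w * (s - p)⁻¹ + dslope F p s := fun s hs => by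
    have hs' : s - p ≠ 0 := sub_ne_zero.2 hs
    rw [dslope_of_ne _ hs, slope_def_field, hF, Function.update_of_ne hs, Function.update_self]
    field_simp
    ring
  obtain ⟨n1, n2, n3, n4⟩ := mem_boundary_ne ha hb hc hd
  have hDc := hD.continuousOn
  have key : ∀ (g : ℝ → ℂ) (u v : ℝ), Continuous g → (∀ t, g t ≠ p) →
      (∀ t ∈ Set.Icc u v, g t ∈ R) → u ≤ v → ∫ t in u..v, f (g t) =
        w * (∫ t in u..v, (g t - p)⁻¹) + ∫ t in u..v, dslope F p (g t) := by
    intro g u v hg hne hm huv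
    rw [← intervalIntegral.integral_const_mul, ← intervalIntegral.integral_add]
    · exact intervalIntegral.integral_congr fun t _ => hfe _ (hne t)
    · exact (continuous_const.mul ((hg.sub continuous_const).inv₀
        fun t => sub_ne_zero.2 (hne t))).intervalIntegrable _ _
    · refine ContinuousOn.intervalIntegrable ?_
      rw [Set.uIcc_of_le huv]
      exact hDc.comp hg.continuousOn hm
  have hinv := rectBoundaryIntegral_inv_sub ha hb hc hd
  rw [rectBoundaryIntegral] at h0 hinv ⊢
  rw [key _ _ _ (by fun_prop) n1 (fun t ht => ⟨by simpa using ht, by simp [hcd]⟩) hab,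
    key _ _ _ (by fun_prop) n2 (fun t ht => ⟨by simpa using ht, by simp [hcd]⟩) hab,
    key _ _ _ (by fun_prop) n3 (fun t ht => ⟨by simp [hab], by simpa using ht⟩) hcd,
    key _ _ _ (by fun_prop) n4 (fun t ht => ⟨by simp [hab], by simpa using ht⟩) hcd]
  linear_combination w * hinv + h0

/-- Two rectangles with a common vertical side. -/
theorem rectBoundaryIntegral_add_adjacent {f : ℂ → ℂ} {a b b' c d : ℝ} (hab : a ≤ b)
    (hbb : b ≤ b')
    (h₁ : ContinuousOn (fun x : ℝ => f (x + c * Complex.I)) (Set.Icc a b'))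
    (h₂ : ContinuousOn (fun x : ℝ => f (x + d * Complex.I)) (Set.Icc a b')) :
    rectBoundaryIntegral f a b c d + rectBoundaryIntegral f b b' c d =
      rectBoundaryIntegral f a b' c d := by
  have hi : ∀ {y : ℝ}, ContinuousOn (fun x : ℝ => f (x + y * Complex.I)) (Set.Icc a b') →
      (∫ x in a..b, f (x + y * Complex.I)) + (∫ x in b..b', f (x + y * Complex.I)) =
        ∫ x in a..b', f (x + y * Complex.I) := fun h => by
    apply intervalIntegral.integral_add_adjacent_intervals
    · refine (h.mono ?_).intervalIntegrable
      rw [Set.uIcc_of_le hab]; exact Set.Icc_subset_Icc_right hbb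
    · refine (h.mono ?_).intervalIntegrable
      rw [Set.uIcc_of_le hbb]; exact Set.Icc_subset_Icc_left hab
  simp only [rectBoundaryIntegral]
  linear_combination hi h₁ - hi h₂

/-- The boundary integrals over `[aₙ, b] × [c, d]` converge to the integral over the boundary of
the half-infinite strip as `aₙ → -∞`. -/
theorem tendsto_rectBoundaryIntegral {f : ℂ → ℂ} {b c d : ℝ} {a B : ℕ → ℝ}
    (h₁ : MeasureTheory.IntegrableOn (fun x : ℝ => f (x + c * Complex.I)) (Set.Iic b))
    (h₂ : MeasureTheory.IntegrableOn (fun x : ℝ => f (x + d * Complex.I)) (Set.Iic b))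
    (ha : Filter.Tendsto a Filter.atTop Filter.atBot)
    (hB : Filter.Tendsto B Filter.atTop (𝓝 0)) (hcd : c ≤ d)
    (hf : ∀ᶠ n in Filter.atTop, ∀ y ∈ Set.Icc c d, ‖f (a n + y * Complex.I)‖ ≤ B n) :
    Filter.Tendsto (fun n => rectBoundaryIntegral f (a n) b c d) Filter.atTop
      (𝓝 ((∫ x in Set.Iic b, f (x + c * Complex.I)) - (∫ x in Set.Iic b, f (x + d * Complex.I)) +
        Complex.I * ∫ y in c..d, f (b + y * Complex.I))) := by
  have h0 : Filter.Tendsto (fun n => ∫ y in c..d, f (a n + y * Complex.I)) Filter.atTop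
      (𝓝 0) := by
    have hB' : Filter.Tendsto (fun n => B n * |d - c|) Filter.atTop (𝓝 0) := by
      simpa using hB.mul_const |d - c|
    refine squeeze_zero_norm' ?_ hB'
    filter_upwards [hf] with n hn
    refine intervalIntegral.norm_integral_le_of_norm_le_const fun y hy => hn y ?_
    rw [Set.uIoc_of_le hcd] at hy
    exact Set.Ioc_subset_Icc_self hy
  have := (((MeasureTheory.intervalIntegral_tendsto_integral_Iic b h₁ ha).sub
    (MeasureTheory.intervalIntegral_tendsto_integral_Iic b h₂ ha)).add
    (tendsto_const_nhds (x := Complex.I * ∫ y in c..d, f (b + y * Complex.I)))).sub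
    (h0.const_mul Complex.I)
  simpa [rectBoundaryIntegral] using this

/-! ### Bounds for Γ and sin, residues of Γ -/

theorem Complex.norm_Gamma_le_Gamma_re {s : ℂ} (hs : 0 < s.re) :
    ‖Complex.Gamma s‖ ≤ Real.Gamma s.re := by
  rw [Complex.Gamma_eq_integral hs, Real.Gamma_eq_integral hs, Complex.GammaIntegral]
  refine MeasureTheory.norm_integral_le_of_norm_le (Real.GammaIntegral_convergent hs) ?_
  filter_upwards [MeasureTheory.ae_restrict_mem measurableSet_Ioi] with x hx
  rw [norm_mul, Complex.norm_real, Complex.norm_cpow_eq_rpow_re_of_pos hx,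
    Real.norm_of_nonneg (Real.exp_pos _).le]
  simp

/-- Write s = u + v with u = Re s - 1 and v = 1 + i Im s. Then Γ(u) Γ(v) = Γ(s) B(u, v), where |B(u,
v)| ≤ ∫₀¹ x^{u-1} dx = 1/u, and u Γ(u) = Γ(Re s). On a horizontal strip |Γ(1 + i Im s)| is bounded
below, so |Γ(s)| is comparable with Γ(Re s). -/
theorem Complex.Gamma_re_mul_norm_le {s : ℂ} (hs : 1 < s.re) :
    Real.Gamma s.re * ‖Complex.Gamma (1 + s.im * Complex.I)‖ ≤ ‖Complex.Gamma s‖ := by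
  set u : ℝ := s.re - 1 with hu
  have hu0 : 0 < u := sub_pos.2 hs
  set v : ℂ := 1 + s.im * Complex.I with hv
  have hvre : v.re = 1 := by simp [hv]
  have hsum : (u : ℂ) + v = s := by
    apply Complex.ext <;> simp [hu, hv]
  have hB : ‖Complex.betaIntegral u v‖ ≤ 1 / u := by
    have h1 : ∫ x in (0 : ℝ)..1, x ^ (u - 1) = 1 / u := by
      rw [integral_rpow (Or.inl (by linarith))]
      simp [Real.zero_rpow hu0.ne']
    rw [← h1, Complex.betaIntegral]
    refine intervalIntegral.norm_integral_le_of_norm_le zero_le_one ?_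
      (intervalIntegral.intervalIntegrable_rpow' (by linarith))
    refine Filter.Eventually.of_forall fun x hx => ?_
    rw [norm_mul, Complex.norm_cpow_eq_rpow_re_of_pos hx.1]
    have h2 : ‖(1 - (x : ℂ)) ^ (v - 1)‖ ≤ 1 := by
      rcases hx.2.lt_or_eq with h | h
      · rw [← Complex.ofReal_one, ← Complex.ofReal_sub,
          Complex.norm_cpow_eq_rpow_re_of_pos (sub_pos.2 h)]
        simp [hv]
      -- At x = 1 the base is 0: the power is 1 if the exponent is 0, and 0 otherwise.
      · rw [h, Complex.ofReal_one, sub_self]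
        rcases eq_or_ne (v - 1) 0 with h0 | h0
        · simp [h0]
        · simp [Complex.zero_cpow h0]
    have h3 : ((u : ℂ) - 1).re = u - 1 := by simp
    rw [h3]
    exact mul_le_of_le_one_right (Real.rpow_nonneg hx.1.le _) h2
  have h := congrArg norm (Complex.Gamma_mul_Gamma_eq_betaIntegral (s := u) (t := v)
    (by simpa using hu0) (by simp [hvre]))
  rw [hsum, norm_mul, norm_mul, Complex.Gamma_ofReal, Complex.norm_real,
    Real.norm_of_nonneg (Real.Gamma_pos_of_pos hu0).le] at h
  have h4 : Real.Gamma s.re = u * Real.Gamma u := by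
    rw [← Real.Gamma_add_one hu0.ne', hu]; ring_nf
  rw [h4, mul_assoc, h]
  calc u * (‖Complex.Gamma s‖ * ‖Complex.betaIntegral u v‖)
      ≤ u * (‖Complex.Gamma s‖ * (1 / u)) := by gcongr
    _ = ‖Complex.Gamma s‖ := by field_simp

/-- The Gamma function grows faster than every exponential. -/
theorem Real.rpow_mul_exp_neg_le_Gamma {x B : ℝ} (hx : 1 ≤ x) (hB : 0 < B) :
    B ^ (x - 1) * Real.exp (-B) ≤ Real.Gamma x := by
  have hx0 : 0 < x := by linarith
  have hi := Real.GammaIntegral_convergent hx0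
  have hsub : Set.Ioi B ⊆ Set.Ioi (0 : ℝ) := Set.Ioi_subset_Ioi hB.le
  have hE : MeasureTheory.IntegrableOn (fun t : ℝ => Real.exp (-t)) (Set.Ioi B) :=
    integrableOn_exp_neg_Ioi B
  -- Only the range t > B of Euler's integral is kept, where t^{x-1} ≥ B^{x-1}.
  calc B ^ (x - 1) * Real.exp (-B) = ∫ t in Set.Ioi B, B ^ (x - 1) * Real.exp (-t) := by
        rw [MeasureTheory.integral_const_mul, integral_exp_neg_Ioi]
    _ ≤ ∫ t in Set.Ioi B, Real.exp (-t) * t ^ (x - 1) := by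
        refine MeasureTheory.setIntegral_mono_on (hE.const_mul _) (hi.mono_set hsub)
          measurableSet_Ioi fun t ht => ?_
        rw [mul_comm]
        gcongr
        exact le_of_lt ht
    _ ≤ ∫ t in Set.Ioi 0, Real.exp (-t) * t ^ (x - 1) := by
        refine MeasureTheory.setIntegral_mono_set hi ?_ hsub.eventuallyLE
        filter_upwards [MeasureTheory.ae_restrict_mem measurableSet_Ioi] with t ht
        exact mul_nonneg (Real.exp_pos _).le (Real.rpow_nonneg (le_of_lt ht) _)
    _ = Real.Gamma x := (Real.Gamma_eq_integral hx0).symm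

theorem Real.exists_rpow_le_mul_exp {a : ℝ} (ha : 0 ≤ a) {b : ℝ} (hb : 0 < b) :
    ∃ C, 0 < C ∧ ∀ t : ℝ, 0 < t → t ^ a ≤ C * Real.exp (b * t) := by
  have h1 := tendsto_rpow_mul_exp_neg_mul_atTop_nhds_zero a b hb
  obtain ⟨T, hT⟩ := Filter.eventually_atTop.1 (h1.eventually (gt_mem_nhds zero_lt_one))
  set T' := max T 1
  have hT' : 0 < T' := lt_of_lt_of_le one_pos (le_max_right _ _)
  refine ⟨T' ^ a + 1, by positivity, fun t ht => ?_⟩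
  rcases le_total t T' with h | h
  · calc t ^ a ≤ T' ^ a := Real.rpow_le_rpow ht.le h ha
      _ ≤ (T' ^ a + 1) * 1 := by linarith
      _ ≤ (T' ^ a + 1) * Real.exp (b * t) := by
        gcongr
        exact Real.one_le_exp (by positivity)
  · have h2 := hT t ((le_max_left _ _).trans h)
    calc t ^ a = t ^ a * Real.exp (-b * t) * Real.exp (b * t) := by
          rw [mul_assoc, ← Real.exp_add]; simp
      _ ≤ 1 * Real.exp (b * t) := by gcongr
      _ ≤ (T' ^ a + 1) * Real.exp (b * t) := by
        gcongr
        have : 0 ≤ T' ^ a := by positivity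
        linarith

/-- In Euler's integral split e^{-t} into two factors e^{-t/2}: one absorbs t^a, the other leaves
2^x Γ(x). The crude factor 2^x is harmless against superexponential decay. -/
theorem Real.exists_Gamma_add_le {a : ℝ} (ha : 0 ≤ a) :
    ∃ C, 0 < C ∧ ∀ x : ℝ, 0 < x → Real.Gamma (a + x) ≤ C * 2 ^ x * Real.Gamma x := by
  obtain ⟨C, hC, h⟩ := Real.exists_rpow_le_mul_exp ha (b := 1 / 2) (by norm_num)
  refine ⟨C, hC, fun x hx => ?_⟩
  have hax : 0 < a + x := by linarith
  have h2 := Real.integral_rpow_mul_exp_neg_mul_Ioi hx (r := 1 / 2) (by norm_num)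
  rw [one_div_one_div] at h2
  rw [Real.Gamma_eq_integral hax, mul_assoc, ← h2, ← MeasureTheory.integral_const_mul]
  have hi : MeasureTheory.IntegrableOn
      (fun t : ℝ => t ^ (x - 1) * Real.exp (-(1 / 2 * t))) (Set.Ioi 0) := by
    have := integrableOn_rpow_mul_exp_neg_mul_rpow (s := x - 1) (p := 1) (b := 1 / 2)
      (by linarith) one_pos (by norm_num)
    simpa using this
  refine MeasureTheory.setIntegral_mono_on (Real.GammaIntegral_convergent hax)
    (hi.const_mul C) measurableSet_Ioi fun t ht => ?_
  have ht0 : 0 < t := ht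
  have e1 : t ^ (a + x - 1) = t ^ a * t ^ (x - 1) := by
    rw [← Real.rpow_add ht0]; ring_nf
  have e2 : Real.exp (-t) = Real.exp (-(1 / 2 * t)) * Real.exp (-(1 / 2 * t)) := by
    rw [← Real.exp_add]; ring_nf
  have e3 : t ^ a * Real.exp (-(1 / 2 * t)) ≤ C := by
    calc t ^ a * Real.exp (-(1 / 2 * t))
        ≤ C * Real.exp (1 / 2 * t) * Real.exp (-(1 / 2 * t)) := by gcongr; exact h t ht0
      _ = C := by rw [mul_assoc, ← Real.exp_add]; simp
  calc Real.exp (-t) * t ^ (a + x - 1)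
      = (t ^ a * Real.exp (-(1 / 2 * t))) * (t ^ (x - 1) * Real.exp (-(1 / 2 * t))) := by
        rw [e1, e2]; ring
    _ ≤ C * (t ^ (x - 1) * Real.exp (-(1 / 2 * t))) := by gcongr

theorem Complex.exists_le_norm_Gamma_one_add_mul_I (Y : ℝ) :
    ∃ m, 0 < m ∧ ∀ y : ℝ, |y| ≤ Y → m ≤ ‖Complex.Gamma (1 + y * Complex.I)‖ := by
  rcases lt_or_ge Y 0 with hY | hY
  · exact ⟨1, one_pos, fun y hy => absurd (hy.trans_lt hY) (abs_nonneg y).not_gt⟩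
  have hre : ∀ y : ℝ, 0 < (1 + y * Complex.I : ℂ).re := fun y => by simp
  have hc : Continuous fun y : ℝ => ‖Complex.Gamma (1 + y * Complex.I)‖ := by
    refine Continuous.norm (continuous_iff_continuousAt.2 fun y => ?_)
    refine ContinuousAt.comp (f := fun y : ℝ => (1 + y * Complex.I : ℂ)) ?_ (by fun_prop)
    refine (Complex.differentiableAt_Gamma _ fun m h => ?_).continuousAt
    have := hre y
    rw [h] at this
    simp only [Complex.neg_re, Complex.natCast_re] at this
    linarith [(Nat.cast_nonneg m : (0 : ℝ) ≤ m)]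
  obtain ⟨y₀, -, h⟩ := (isCompact_Icc (a := -Y) (b := Y)).exists_isMinOn
    ⟨0, by simp [hY]⟩ hc.continuousOn
  exact ⟨_, norm_pos_iff.2 (Complex.Gamma_ne_zero_of_re_pos (hre y₀)),
    fun y hy => h (abs_le.1 hy)⟩

/-- Both lower bounds for |sin πs| on the contour come from this identity: sinh(π|y|) on the line Im
s = y, and 1 on the lines Re s = -n - 1/2. -/
theorem Complex.norm_sin_sq (z : ℂ) :
    ‖Complex.sin z‖ ^ 2 = Real.sin z.re ^ 2 + Real.sinh z.im ^ 2 := by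
  rw [Complex.sin_eq, ← Complex.normSq_eq_norm_sq]
  simp only [← Complex.ofReal_sin, ← Complex.ofReal_cos, ← Complex.ofReal_sinh,
    ← Complex.ofReal_cosh, ← Complex.ofReal_mul]
  rw [Complex.normSq_add_mul_I]
  have h1 := Real.cosh_sq z.im
  have h2 := Real.sin_sq_add_cos_sq z.re
  rw [mul_pow, mul_pow, h1]
  linear_combination Real.sinh z.im ^ 2 * h2

theorem Complex.sinh_le_norm_sin {y : ℝ} (s : ℂ) (hy : |s.im| = y) :
    Real.sinh y ≤ ‖Complex.sin s‖ := by
  refine le_of_sq_le_sq ?_ (norm_nonneg _)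
  rw [Complex.norm_sin_sq, ← hy]
  have : Real.sinh |s.im| ^ 2 = Real.sinh s.im ^ 2 := by
    rcases abs_choice s.im with h | h <;> rw [h]
    rw [Real.sinh_neg, neg_sq]
  rw [this]
  nlinarith [sq_nonneg (Real.sin s.re)]

/-- Induction through Γ(s) = Γ(s + 1) / s, which moves each pole to its right neighbour. -/
theorem Complex.tendsto_add_mul_Gamma_nhds_neg_nat (k : ℕ) :
    Filter.Tendsto (fun s : ℂ => (s + k) * Complex.Gamma s) (𝓝[≠] (-(k : ℂ)))
      (𝓝 ((-1) ^ k / (k.factorial : ℂ))) := by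
  induction k with
  | zero => simpa using Complex.tendsto_self_mul_Gamma_nhds_zero
  | succ k ih =>
    have hk : (-((k + 1 : ℕ) : ℂ)) ≠ 0 := neg_ne_zero.2 (Nat.cast_ne_zero.2 k.succ_ne_zero)
    have hshift : Filter.Tendsto (fun s : ℂ => s + 1) (𝓝[≠] (-((k + 1 : ℕ) : ℂ)))
        (𝓝[≠] (-(k : ℂ))) := by
      refine tendsto_nhdsWithin_of_tendsto_nhds_of_eventually_within _ ?_ ?_
      · have : Filter.Tendsto (fun s : ℂ => s + 1) (𝓝 (-((k + 1 : ℕ) : ℂ)))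
            (𝓝 (-((k + 1 : ℕ) : ℂ) + 1)) := (by fun_prop : Continuous fun s : ℂ => s + 1).tendsto _
        have e : -((k + 1 : ℕ) : ℂ) + 1 = -(k : ℂ) := by push_cast; ring
        rw [e] at this
        exact this.mono_left nhdsWithin_le_nhds
      · filter_upwards [self_mem_nhdsWithin] with s hs h
        apply hs
        have h' : s + 1 = -(k : ℂ) := h
        simp only [Set.mem_singleton_iff]
        push_cast
        linear_combination h'
    have h1 := (ih.comp hshift).div
      ((continuous_id.tendsto (-((k + 1 : ℕ) : ℂ))).mono_left nhdsWithin_le_nhds) hk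
    have e : ((-1) ^ k / (k.factorial : ℂ)) / id (-((k + 1 : ℕ) : ℂ)) =
        (-1) ^ (k + 1) / ((k + 1).factorial : ℂ) := by
      rw [Nat.factorial_succ]
      have : (k.factorial : ℂ) ≠ 0 := Nat.cast_ne_zero.2 k.factorial_ne_zero
      have h2 : ((k + 1 : ℕ) : ℂ) ≠ 0 := Nat.cast_ne_zero.2 k.succ_ne_zero
      push_cast at h2 ⊢
      simp only [id]
      field_simp
      ring
    rw [e] at h1
    refine h1.congr' ?_
    filter_upwards [nhdsWithin_le_nhds (isOpen_ne.mem_nhds hk)] with s hs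
    have hs' : s ≠ 0 := hs
    rw [Pi.div_apply, Function.comp_apply, id, Complex.Gamma_add_one s hs']
    push_cast
    field_simp
    ring

/-! ### The Mellin-Barnes integral as a residue series -/

/-- The general term of the residue series of the Fox function. -/
noncomputable def laplaceFoxTerm (β ρ : ℝ) (z : ℂ) (k : ℕ) : ℂ :=
  (-z) ^ k * Complex.Gamma ((ρ : ℂ) + k) /
    ((k.factorial : ℂ) * Complex.Gamma (1 - (β : ℂ) + β * ρ + β * k))

theorem laplaceFoxParams_valid {β : ℝ} (hβ : 0 < β) (ρ : ℝ) : (laplaceFoxParams β ρ).Valid := by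
  refine ⟨le_rfl, le_rfl, by norm_num, fun j => ?_, fun j => ?_, ?_⟩
  · fin_cases j; simp [laplaceFoxParams]
  · fin_cases j <;> simp [laplaceFoxParams, hβ]
  · simp [laplaceFoxParams, hβ]

theorem laplaceFoxParams_integrand (β ρ : ℝ) (z s : ℂ) :
    (laplaceFoxParams β ρ).integrand z s =
      Complex.Gamma s * Complex.Gamma (ρ - s) *
        (Complex.Gamma (1 - (β : ℂ) + β * ρ - β * s))⁻¹ * z ^ (-s) := by
  have f1 : (Finset.univ.filter fun j : Fin 2 => (j : ℕ) < 1) = {0} := by decide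
  have f2 : (Finset.univ.filter fun j : Fin 2 => 1 ≤ (j : ℕ)) = {1} := by decide
  have f3 : (Finset.univ.filter fun j : Fin 1 => (j : ℕ) < 1) = {0} := by decide
  have f4 : (Finset.univ.filter fun j : Fin 1 => 1 ≤ (j : ℕ)) = ∅ := by decide
  rw [FoxParams.integrand, FoxParams.theta, f1, f2, f3, f4]
  simp only [Finset.prod_singleton, Finset.prod_empty, laplaceFoxParams]
  have e : (1 - (β : ℂ) * (1 - ρ) - s * β) = 1 - (β : ℂ) + β * ρ - β * s := by ring
  simp [div_eq_mul_inv, e]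

/-- Only the two innermost poles matter: 0, the rightmost one of Γ(s), and ρ, the leftmost one of
Γ(ρ - s). -/
theorem laplaceFoxParams_isLoop_iff {β ρ γ φ₁ φ₂ : ℝ} :
    (laplaceFoxParams β ρ).IsLoop γ φ₁ φ₂ ↔ 0 < γ ∧ γ < ρ ∧ φ₁ < 0 ∧ 0 < φ₂ := by
  constructor
  · rintro ⟨-, h1, h2⟩
    have h3 := h1 0 (by norm_num) 0 0 (by simp [laplaceFoxParams])
    have h4 := h2 0 (by norm_num) 0 ρ (by simp [laplaceFoxParams])
    simp only [Complex.zero_re, Complex.zero_im] at h3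
    refine ⟨h3.1, ?_, h3.2.1, h3.2.2⟩
    by_contra h
    exact h4 ⟨by simpa using h, by simpa using h3.2.1.le, by simpa using h3.2.2.le⟩
  · rintro ⟨h0, hρ, h1, h2⟩
    refine ⟨h1.trans h2, fun j hj k s hs => ?_, fun j hj k s hs => ?_⟩
    · have : j = 0 := Fin.ext (by simpa using hj)
      subst this
      have hs' : s = -(k : ℂ) := by simpa [laplaceFoxParams] using hs
      subst hs'
      simp only [Complex.neg_re, Complex.natCast_re, Complex.neg_im, Complex.natCast_im, neg_zero]
      exact ⟨by linarith [(Nat.cast_nonneg k : (0 : ℝ) ≤ k)], h1, h2⟩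
    · have : j = 0 := Subsingleton.elim _ _
      subst this
      have hs' : (ρ : ℂ) - s = -(k : ℂ) := by simpa [laplaceFoxParams] using hs
      have hre : ρ - s.re = -k := by simpa using congrArg Complex.re hs'
      rintro ⟨h3, -⟩
      linarith [(Nat.cast_nonneg k : (0 : ℝ) ≤ k)]

theorem differentiableAt_laplaceFoxParams_integrand {β ρ : ℝ} {z s : ℂ} (hz : z ≠ 0)
    (hs : s.re < ρ) (hs' : ∀ m : ℕ, s ≠ -m) :
    DifferentiableAt ℂ ((laplaceFoxParams β ρ).integrand z) s := by
  have : (laplaceFoxParams β ρ).integrand z = fun s => Complex.Gamma s * Complex.Gamma (ρ - s) *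
        (Complex.Gamma (1 - (β : ℂ) + β * ρ - β * s))⁻¹ * z ^ (-s) :=
    funext fun s => laplaceFoxParams_integrand β ρ z s
  rw [this]
  refine (((Complex.differentiableAt_Gamma _ hs').mul ?_).mul ?_).mul ?_
  · refine DifferentiableAt.comp s (Complex.differentiableAt_Gamma _ fun m h => ?_) (by fun_prop)
    have := congrArg Complex.re h
    simp only [Complex.sub_re, Complex.ofReal_re, Complex.neg_re, Complex.natCast_re] at this
    linarith [(Nat.cast_nonneg m : (0 : ℝ) ≤ m)]
  · exact DifferentiableAt.comp s (f := fun s : ℂ => 1 - (β : ℂ) + β * ρ - β * s)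
      (Complex.differentiable_one_div_Gamma _) (by fun_prop)
  · exact (by fun_prop : DifferentiableAt ℂ (fun s : ℂ => -s) s).const_cpow (Or.inl hz)

theorem continuousOn_laplaceFoxParams_integrand {β ρ γ y : ℝ} {z : ℂ} (hz : z ≠ 0)
    (hγ : γ < ρ) (hy : y ≠ 0) :
    ContinuousOn (fun x : ℝ => (laplaceFoxParams β ρ).integrand z (x + y * Complex.I))
      (Set.Iic γ) := by
  intro x hx
  refine ContinuousAt.continuousWithinAt (ContinuousAt.comp
    (g := (laplaceFoxParams β ρ).integrand z) (f := fun x : ℝ => (x + y * Complex.I : ℂ)) ?_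
    (by fun_prop))
  refine (differentiableAt_laplaceFoxParams_integrand hz ?_ fun m h => hy ?_).continuousAt
  · simpa using lt_of_le_of_lt hx hγ
  · simpa using congrArg Complex.im h

theorem tendsto_residue_laplaceFoxParams {β ρ : ℝ} (hρ : 0 < ρ) {z : ℂ} (hz : z ≠ 0) (k : ℕ) :
    Filter.Tendsto (fun s : ℂ => (s + k) * (laplaceFoxParams β ρ).integrand z s)
      (𝓝[≠] (-(k : ℂ))) (𝓝 (laplaceFoxTerm β ρ z k)) := by
  have hk : (0 : ℝ) ≤ k := Nat.cast_nonneg k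
  have hd : DifferentiableAt ℂ (fun s : ℂ => Complex.Gamma (ρ - s) *
        (Complex.Gamma (1 - (β : ℂ) + β * ρ - β * s))⁻¹ * z ^ (-s)) (-(k : ℂ)) := by
    refine (DifferentiableAt.mul ?_ ?_).mul ?_
    · refine DifferentiableAt.comp _ (Complex.differentiableAt_Gamma _ fun m h => ?_)
        (by fun_prop)
      have := congrArg Complex.re h
      simp only [Complex.sub_re, Complex.ofReal_re, Complex.neg_re, Complex.natCast_re] at this
      linarith [(Nat.cast_nonneg m : (0 : ℝ) ≤ m)]
    · exact DifferentiableAt.comp _ (f := fun s : ℂ => 1 - (β : ℂ) + β * ρ - β * s)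
        (Complex.differentiable_one_div_Gamma _) (by fun_prop)
    · exact (by fun_prop : DifferentiableAt ℂ (fun s : ℂ => -s) _).const_cpow (Or.inl hz)
  have h := (Complex.tendsto_add_mul_Gamma_nhds_neg_nat k).mul
    (hd.continuousAt.tendsto.mono_left nhdsWithin_le_nhds)
  have e : (-1) ^ k / (k.factorial : ℂ) * (Complex.Gamma (ρ - -(k : ℂ)) *
      (Complex.Gamma (1 - (β : ℂ) + β * ρ - β * -(k : ℂ)))⁻¹ * z ^ (- -(k : ℂ))) =
      laplaceFoxTerm β ρ z k := by
    rw [laplaceFoxTerm, neg_neg, Complex.cpow_natCast, neg_pow z, sub_neg_eq_add, mul_neg,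
      sub_neg_eq_add, div_eq_mul_inv, div_eq_mul_inv, mul_inv]
    ring
  rw [e] at h
  refine h.congr fun s => ?_
  rw [laplaceFoxParams_integrand]
  ring

/-- Cuts along the lines Re s = -k - 1/2 leave a single pole in each piece. -/
theorem rectBoundaryIntegral_laplaceFoxParams {β ρ γ φ₁ φ₂ : ℝ} {z : ℂ} (hz : z ≠ 0)
    (hγ : 0 < γ) (hγρ : γ < ρ) (hφ₁ : φ₁ < 0) (hφ₂ : 0 < φ₂) (N : ℕ) :
    rectBoundaryIntegral ((laplaceFoxParams β ρ).integrand z) (-N - 1 / 2) γ φ₁ φ₂ =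
      2 * Real.pi * Complex.I * ∑ k ∈ Finset.range (N + 1), laplaceFoxTerm β ρ z k := by
  have hρ : 0 < ρ := hγ.trans hγρ
  -- The last condition keeps the pole -k + 1 out of the rectangle. For k = 0 there is no such pole,
  -- and the right side may lie anywhere in (0, ρ).
  have hstrip : ∀ (k : ℕ) (b : ℝ), -(k : ℝ) < b → b < ρ → b < -(k : ℝ) + 1 ∨ k = 0 →
      rectBoundaryIntegral ((laplaceFoxParams β ρ).integrand z) (-k - 1 / 2) b φ₁ φ₂ =
        2 * Real.pi * Complex.I * laplaceFoxTerm β ρ z k := by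
    intro k b hb hbρ hb1
    refine rectBoundaryIntegral_of_simplePole (p := -(k : ℝ)) (by linarith) hb hφ₁ hφ₂ ?_ ?_
    · intro s hs
      have hre := hs.1.1
      simp only [Set.mem_preimage, Set.mem_Icc] at hre
      refine (differentiableAt_laplaceFoxParams_integrand hz (hre.2.trans_lt hbρ)
        fun m hm => hs.2 ?_).differentiableWithinAt
      rw [hm] at hre
      simp only [Complex.neg_re, Complex.natCast_re] at hre
      have hmk : m ≤ k := by
        have h1 : (m : ℝ) < (k : ℝ) + 1 := by linarith
        exact Nat.lt_succ_iff.1 (by exact_mod_cast h1)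
      have hkm : k ≤ m := by
        rcases hb1 with hb1 | hb1
        · have h1 : (k : ℝ) < (m : ℝ) + 1 := by linarith
          exact Nat.lt_succ_iff.1 (by exact_mod_cast h1)
        · omega
      rw [hm, le_antisymm hmk hkm]
      simp
    · simpa [sub_neg_eq_add] using tendsto_residue_laplaceFoxParams hρ hz k
  have hcont {y : ℝ} (hy : y ≠ 0) :=
    continuousOn_laplaceFoxParams_integrand (β := β) hz hγρ hy
  induction N with
  | zero => simpa using hstrip 0 γ (by simpa using hγ) hγρ (Or.inr rfl)
  | succ N ih =>
    have hN : (0 : ℝ) ≤ N := Nat.cast_nonneg N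
    have hN' : ((N + 1 : ℕ) : ℝ) = N + 1 := by push_cast; ring
    rw [← rectBoundaryIntegral_add_adjacent (b := -N - 1 / 2) (by rw [hN']; linarith)
      (by linarith) ((hcont hφ₁.ne).mono Set.Icc_subset_Iic_self)
      ((hcont hφ₂.ne').mono Set.Icc_subset_Iic_self), ih,
      hstrip (N + 1) (-N - 1 / 2) (by rw [hN']; linarith) (by linarith)
        (Or.inl (by rw [hN']; linarith)), Finset.sum_range_succ _ (N + 1)]
    ring

/-- Away from its poles the integrand decays exponentially on horizontal strips. -/
theorem exists_norm_laplaceFoxParams_integrand_le {β ρ : ℝ} (hβ : 0 < β) (hρ : 0 < ρ)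
    {z : ℂ} (hz : z ≠ 0) (Y : ℝ) {δ : ℝ} (hδ : 0 < δ) :
    ∃ C, ∀ s : ℂ, s.re ≤ -1 → |s.im| ≤ Y → δ ≤ ‖Complex.sin (Real.pi * s)‖ →
      ‖(laplaceFoxParams β ρ).integrand z s‖ ≤ C * Real.exp s.re := by
  obtain ⟨C, hC, hG⟩ := Real.exists_Gamma_add_le hρ.le
  obtain ⟨m₁, hm₁, h₁⟩ := Complex.exists_le_norm_Gamma_one_add_mul_I Y
  obtain ⟨m₂, hm₂, h₂⟩ := Complex.exists_le_norm_Gamma_one_add_mul_I (β * Y)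
  set L := |Real.log ‖z‖| with hL
  -- With B = exp b in `Real.rpow_mul_exp_neg_le_Gamma`, the reciprocal Gamma factor contributes
  -- exp(-bβX) = exp(-(1 + L + log 2) X), where X = -Re s. This cancels 2^X from the Gamma quotient
  -- and exp(LX) from the power of z, and leaves exp(-X).
  set b := (1 + L + Real.log 2) / β with hb
  refine ⟨Real.pi / δ * (C / m₁) * (Real.exp (Real.exp b) * Real.exp (b * (β - β * ρ)) / m₂) *
    Real.exp (Real.pi * Y), fun s hre him hs => ?_⟩
  set X := -s.re with hX
  have hX1 : 1 ≤ X := by linarith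
  have hX0 : 0 < X := by linarith
  have r1 : ((ρ : ℂ) - s).re = ρ + X := by simp [hX, sub_eq_add_neg]
  have r2 : (1 - s).re = X + 1 := by simp [hX]; ring
  have r3 : (1 - (β : ℂ) + β * ρ - β * s).re = 1 - β + β * ρ + β * X := by
    simp [hX, sub_eq_add_neg]
  have i2 : (1 - s).im = -s.im := by simp
  have i3 : (1 - (β : ℂ) + β * ρ - β * s).im = -(β * s.im) := by simp
  -- Reflection turns Γ(s) into π / (sin(πs) Γ(1 - s)), so that the Γ(X) bounding Γ(ρ - s) cancels
  -- against the one in Γ(1 - s).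
  have hrefl := Complex.Gamma_mul_Gamma_one_sub s
  have hG1 : Complex.Gamma (1 - s) ≠ 0 :=
    Complex.Gamma_ne_zero_of_re_pos (by rw [r2]; linarith)
  have hGs : ‖Complex.Gamma s‖ = Real.pi / ‖Complex.sin (Real.pi * s)‖ /
      ‖Complex.Gamma (1 - s)‖ := by
    rw [eq_div_iff (norm_ne_zero_iff.2 hG1), ← norm_mul, hrefl, norm_div, Complex.norm_real,
      Real.norm_of_nonneg Real.pi_pos.le]
  have b1 : ‖Complex.Gamma (ρ - s)‖ ≤ C * 2 ^ X * Real.Gamma X := by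
    have := Complex.norm_Gamma_le_Gamma_re (s := ρ - s) (by rw [r1]; linarith)
    rw [r1] at this
    exact this.trans (hG X hX0)
  have b2 : Real.Gamma X * m₁ ≤ ‖Complex.Gamma (1 - s)‖ := by
    have h := Complex.Gamma_re_mul_norm_le (s := 1 - s) (by rw [r2]; linarith)
    rw [r2, i2, Real.Gamma_add_one hX0.ne'] at h
    have hp := Real.Gamma_pos_of_pos hX0
    refine le_trans ?_ h
    gcongr
    · exact le_mul_of_one_le_left hp.le hX1
    · exact h₁ _ (by rwa [abs_neg])
  have b3 : Real.exp (b * (β * ρ - β + β * X)) * Real.exp (-Real.exp b) * m₂ ≤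
      ‖Complex.Gamma (1 - (β : ℂ) + β * ρ - β * s)‖ := by
    have hbx : 0 < β * ρ := mul_pos hβ hρ
    have hbx' : β ≤ β * X := le_mul_of_one_le_right hβ.le hX1
    have h := Complex.Gamma_re_mul_norm_le (s := 1 - (β : ℂ) + β * ρ - β * s)
      (by rw [r3]; linarith)
    rw [r3, i3] at h
    refine le_trans ?_ h
    have h5 := Real.rpow_mul_exp_neg_le_Gamma (x := 1 - β + β * ρ + β * X) (B := Real.exp b)
      (by linarith) (Real.exp_pos b)
    rw [← Real.exp_mul] at h5
    have e : 1 - β + β * ρ + β * X - 1 = β * ρ - β + β * X := by ring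
    rw [e] at h5
    refine mul_le_mul h5 (h₂ _ ?_) hm₂.le ((by positivity : (0 : ℝ) ≤ _).trans h5)
    rw [abs_neg, abs_mul, abs_of_pos hβ]
    exact mul_le_mul_of_nonneg_left him hβ.le
  have b4 : ‖z ^ (-s)‖ ≤ Real.exp (L * X) * Real.exp (Real.pi * Y) := by
    rw [Complex.norm_cpow_of_ne_zero hz, Real.rpow_def_of_pos (norm_pos_iff.2 hz), ← Real.exp_sub,
      ← Real.exp_add, Real.exp_le_exp]
    have h6 : Real.log ‖z‖ * (-s).re ≤ L * X := by
      rw [Complex.neg_re]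
      exact mul_le_mul_of_nonneg_right (le_abs_self _) hX0.le
    have h7 : -(z.arg * (-s).im) ≤ Real.pi * Y := by
      rw [Complex.neg_im, mul_neg, neg_neg]
      calc z.arg * s.im ≤ |z.arg * s.im| := le_abs_self _
        _ = |z.arg| * |s.im| := abs_mul _ _
        _ ≤ Real.pi * Y := by
          gcongr
          exact Complex.abs_arg_le_pi z
    linarith
  have hΓX := Real.Gamma_pos_of_pos hX0
  rw [laplaceFoxParams_integrand, norm_mul, norm_mul, norm_mul, norm_inv, hGs]
  calc Real.pi / ‖Complex.sin (Real.pi * s)‖ / ‖Complex.Gamma (1 - s)‖ *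
        ‖Complex.Gamma (ρ - s)‖ * ‖Complex.Gamma (1 - (β : ℂ) + β * ρ - β * s)‖⁻¹ * ‖z ^ (-s)‖
      ≤ Real.pi / δ / (Real.Gamma X * m₁) * (C * 2 ^ X * Real.Gamma X) *
        (Real.exp (b * (β * ρ - β + β * X)) * Real.exp (-Real.exp b) * m₂)⁻¹ *
        (Real.exp (L * X) * Real.exp (Real.pi * Y)) := by
        have := Real.pi_pos
        gcongr
    _ = Real.pi / δ * (C / m₁) * (Real.exp (Real.exp b) * Real.exp (b * (β - β * ρ)) / m₂) *
        Real.exp (Real.pi * Y) * Real.exp s.re := by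
        have e1 : (2 : ℝ) ^ X = Real.exp (Real.log 2 * X) := Real.rpow_def_of_pos two_pos X
        have e2 : b * β = 1 + L + Real.log 2 := by rw [hb]; field_simp
        have e3 : (Real.exp (b * (β * ρ - β + β * X)) * Real.exp (-Real.exp b) * m₂)⁻¹ =
            Real.exp (Real.exp b) * Real.exp (b * (β - β * ρ)) *
              Real.exp (-(1 + L + Real.log 2) * X) / m₂ := by
          rw [mul_inv, mul_inv, ← Real.exp_neg, ← Real.exp_neg, neg_neg, ← e2, div_eq_mul_inv]
          congr 1
          simp only [← Real.exp_add]
          congr 1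
          ring
        have e4 : Real.exp s.re = Real.exp (Real.log 2 * X) * Real.exp (L * X) *
            Real.exp (-(1 + L + Real.log 2) * X) := by
          rw [← Real.exp_add, ← Real.exp_add]
          congr 1
          rw [hX]; ring
        rw [e1, e3, e4]
        field_simp

theorem integrableOn_Iic_of_continuousOn_of_le_exp {f : ℝ → ℂ} {b C : ℝ}
    (hf : ContinuousOn f (Set.Iic b)) (hC : ∀ x ≤ -1, x ≤ b → ‖f x‖ ≤ C * Real.exp x) :
    MeasureTheory.IntegrableOn f (Set.Iic b) := by
  have h1 : MeasureTheory.IntegrableOn f (Set.Iic (min (-1) b)) := by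
    refine MeasureTheory.Integrable.mono' (g := fun x => C * Real.exp x)
      ((integrableOn_exp_Iic _).const_mul C) ?_ ?_
    · exact (hf.mono (Set.Iic_subset_Iic.2 (min_le_right _ _))).aestronglyMeasurable
        measurableSet_Iic
    · filter_upwards [MeasureTheory.ae_restrict_mem measurableSet_Iic] with x hx
      exact hC x (hx.trans (min_le_left _ _)) (hx.trans (min_le_right _ _))
  have h2 : MeasureTheory.IntegrableOn f (Set.Icc (min (-1) b) b) :=
    (hf.mono Set.Icc_subset_Iic_self).integrableOn_Icc
  rw [← Set.Iic_union_Icc_eq_Iic (min_le_right (-1) b)]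
  exact h1.union h2

/-- The loop is the limit of rectangles with left side Re s = -n - 1/2, and their boundary integrals
are 2πi times partial sums of the series. Its convergence is assumed here; `hasSum_laplaceFoxTerm`
provides it. -/
theorem laplaceFoxParams_hasContourValue {β ρ : ℝ} (hβ : 0 < β) (hρ : 0 < ρ)
    {z w : ℂ} (hz : z ≠ 0) (hw : HasSum (laplaceFoxTerm β ρ z) w) :
    (laplaceFoxParams β ρ).HasContourValue z w := by
  refine ⟨⟨ρ / 2, -1, 1, laplaceFoxParams_isLoop_iff.2 ⟨by linarith, by linarith, by norm_num,
    by norm_num⟩⟩, fun γ φ₁ φ₂ hloop => ?_⟩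
  obtain ⟨hγ, hγρ, hφ₁, hφ₂⟩ := laplaceFoxParams_isLoop_iff.1 hloop
  set f := (laplaceFoxParams β ρ).integrand z with hf
  have hint : ∀ y : ℝ, y ≠ 0 → MeasureTheory.IntegrableOn
      (fun x : ℝ => f (x + y * Complex.I)) (Set.Iic γ) := by
    intro y hy
    -- On a horizontal line off the real axis |sin πs| ≥ sinh(π|y|) > 0.
    obtain ⟨C, hC⟩ := exists_norm_laplaceFoxParams_integrand_le hβ hρ hz |y|
      (δ := Real.sinh (Real.pi * |y|))
      (Real.sinh_pos_iff.2 (mul_pos Real.pi_pos (abs_pos.2 hy)))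
    refine integrableOn_Iic_of_continuousOn_of_le_exp (C := C)
      (continuousOn_laplaceFoxParams_integrand hz hγρ hy) fun x hx _ => ?_
    have := hC (x + y * Complex.I) (by simpa using hx) (by simp)
      (Complex.sinh_le_norm_sin _ (by simp [abs_mul, abs_of_pos Real.pi_pos]))
    simpa using this
  have hvert : IntervalIntegrable (fun y : ℝ => f (γ + y * Complex.I)) MeasureTheory.volume
      φ₁ φ₂ := by
    refine Continuous.intervalIntegrable (continuous_iff_continuousAt.2 fun y => ?_) _ _
    refine ContinuousAt.comp (g := f) (f := fun y : ℝ => (γ + y * Complex.I : ℂ)) ?_ (by fun_prop)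
    refine (differentiableAt_laplaceFoxParams_integrand hz (by simpa using hγρ)
      fun m h => ?_).continuousAt
    have := congrArg Complex.re h
    simp at this
    linarith [(Nat.cast_nonneg m : (0 : ℝ) ≤ m)]
  refine ⟨⟨hint φ₁ hφ₁.ne, hvert, hint φ₂ hφ₂.ne'⟩, ?_⟩
  -- On the closing sides Re s = -n - 1/2 one has sin²(π Re s) = 1, so |sin πs| ≥ 1. The bound
  -- applies from n = 1 on, where Re s ≤ -1.
  obtain ⟨C, hC⟩ := exists_norm_laplaceFoxParams_integrand_le hβ hρ hz (max |φ₁| |φ₂|) one_pos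
  have ha : Filter.Tendsto (fun n : ℕ => (-n - 1 / 2 : ℝ)) Filter.atTop Filter.atBot := by
    have : Filter.Tendsto (fun n : ℕ => (n : ℝ) + 1 / 2) Filter.atTop Filter.atTop :=
      Filter.tendsto_atTop_add_const_right _ _ tendsto_natCast_atTop_atTop
    refine (Filter.tendsto_neg_atTop_atBot.comp this).congr fun n => ?_
    simp only [Function.comp]; ring
  have hlim := tendsto_rectBoundaryIntegral (hint φ₁ hφ₁.ne) (hint φ₂ hφ₂.ne') ha
    (B := fun n => C * Real.exp (-n - 1 / 2))
    (by simpa using (Real.tendsto_exp_atBot.comp ha).const_mul C) (hφ₁.trans hφ₂).le (by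
      filter_upwards [Filter.eventually_ge_atTop 1] with n hn y hy
      have hn' : (1 : ℝ) ≤ n := by exact_mod_cast hn
      have := hC (((-n - 1 / 2 : ℝ) : ℂ) + y * Complex.I) ?_ ?_ ?_
      · simpa using this
      · simp; linarith
      · simpa using abs_le_max_abs_abs hy.1 hy.2
      · refine le_of_sq_le_sq ?_ (norm_nonneg _)
        rw [Complex.norm_sin_sq]
        have e : ((Real.pi : ℂ) * (((-n - 1 / 2 : ℝ) : ℂ) + y * Complex.I)).re =
            -(Real.pi / 2 + n * Real.pi) := by
          simp; ring
        rw [e, Real.sin_neg, Real.sin_add_nat_mul_pi, Real.sin_pi_div_two, neg_sq, mul_pow,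
          ← pow_mul, mul_comm n, pow_mul]
        simp
        positivity)
  have hsum := ((hw.tendsto_sum_nat.comp (Filter.tendsto_add_atTop_nat 1)).const_mul
    (2 * Real.pi * Complex.I))
  have hev : ∀ n : ℕ, rectBoundaryIntegral f ((-n - 1 / 2 : ℝ)) γ φ₁ φ₂ =
      2 * Real.pi * Complex.I * ∑ k ∈ Finset.range (n + 1), laplaceFoxTerm β ρ z k :=
    fun n => rectBoundaryIntegral_laplaceFoxParams hz hγ hγρ hφ₁ hφ₂ n
  have heq := tendsto_nhds_unique (hlim.congr hev) hsum
  rw [FoxParams.loopIntegral]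
  have hpi : (2 * (Real.pi : ℂ) * Complex.I) ≠ 0 := Complex.two_pi_I_ne_zero
  rw [one_div, inv_mul_eq_iff_eq_mul₀ hpi, ← heq]
  ring

/-! ### Euler's integral with a complex rate -/

theorem integrableOn_rpow_sub_one_mul_exp_neg_mul {s b : ℝ} (hs : 0 < s) (hb : 0 < b) :
    MeasureTheory.IntegrableOn (fun x : ℝ => x ^ (s - 1) * Real.exp (-(b * x))) (Set.Ioi 0) := by
  have := integrableOn_rpow_mul_exp_neg_mul_rpow (s := s - 1) (p := 1) (b := b)
    (by linarith) one_pos hb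
  simpa using this

theorem measurable_rpow_mul_cexp (s : ℝ) (l : ℂ) :
    Measurable fun x : ℝ => ((x ^ s : ℝ) : ℂ) * Complex.exp (-(l * x)) := by
  fun_prop

theorem norm_rpow_mul_cexp {x : ℝ} (hx : 0 < x) (s : ℝ) (l : ℂ) :
    ‖((x ^ s : ℝ) : ℂ) * Complex.exp (-(l * x))‖ = x ^ s * Real.exp (-(l.re * x)) := by
  rw [norm_mul, Complex.norm_real, Real.norm_of_nonneg (Real.rpow_nonneg hx.le _),
    Complex.norm_exp]
  simp

theorem integrableOn_rpow_mul_cexp {s : ℝ} (hs : 0 < s) {l : ℂ} (hl : 0 < l.re) :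
    MeasureTheory.IntegrableOn
      (fun x : ℝ => ((x ^ (s - 1) : ℝ) : ℂ) * Complex.exp (-(l * x))) (Set.Ioi 0) := by
  refine (integrableOn_rpow_sub_one_mul_exp_neg_mul hs hl).mono'
    (measurable_rpow_mul_cexp _ _).aestronglyMeasurable ?_
  filter_upwards [MeasureTheory.ae_restrict_mem measurableSet_Ioi] with x hx
  exact (norm_rpow_mul_cexp hx _ _).le

/-- Differentiation under the integral sign: on the ball of radius Re l / 2 about l the real part
exceeds Re l / 2, which gives an integrable majorant of the derivative. -/
theorem differentiableAt_integral_rpow_mul_cexp {s : ℝ} (hs : 0 < s) {l : ℂ} (hl : 0 < l.re) :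
    DifferentiableAt ℂ (fun l : ℂ => ∫ x in Set.Ioi (0 : ℝ),
      ((x ^ (s - 1) : ℝ) : ℂ) * Complex.exp (-(l * x))) l := by
  have hl2 : 0 < l.re / 2 := by linarith
  have hball : ∀ w ∈ Metric.ball l (l.re / 2), l.re / 2 < w.re := fun w hw => by
    have h1 : |(l - w).re| ≤ ‖l - w‖ := Complex.abs_re_le_norm _
    rw [Metric.mem_ball, dist_comm, Complex.dist_eq] at hw
    have h2 := (abs_le.1 h1).2
    simp only [Complex.sub_re] at h2
    linarith
  refine (hasDerivAt_integral_of_dominated_loc_of_deriv_le (Metric.ball_mem_nhds l hl2)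
    (μ := MeasureTheory.volume.restrict (Set.Ioi 0))
    (F := fun w x => ((x ^ (s - 1) : ℝ) : ℂ) * Complex.exp (-(w * x)))
    (F' := fun w x => ((x ^ (s - 1) : ℝ) : ℂ) * (Complex.exp (-(w * x)) * (-(x : ℂ))))
    (bound := fun x => x ^ (s + 1 - 1) * Real.exp (-(l.re / 2 * x)))
    ?_ (integrableOn_rpow_mul_cexp hs hl) ?_ ?_
    (integrableOn_rpow_sub_one_mul_exp_neg_mul (by linarith) hl2) ?_).2.differentiableAt
  · exact Filter.Eventually.of_forall fun w =>
      (measurable_rpow_mul_cexp _ _).aestronglyMeasurable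
  · exact (by fun_prop : Measurable fun x : ℝ =>
      ((x ^ (s - 1) : ℝ) : ℂ) * (Complex.exp (-(l * x)) * (-(x : ℂ)))).aestronglyMeasurable
  · filter_upwards [MeasureTheory.ae_restrict_mem measurableSet_Ioi] with x hx w hw
    have hx0 : (0 : ℝ) < x := hx
    rw [← mul_assoc, norm_mul, norm_rpow_mul_cexp hx0, norm_neg, Complex.norm_real,
      Real.norm_of_nonneg hx0.le]
    have e : x ^ (s + 1 - 1) = x ^ (s - 1) * x := by
      rw [← Real.rpow_add_one hx0.ne']; ring_nf
    rw [e, mul_right_comm]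
    gcongr
    exact (hball w hw).le
  · refine Filter.Eventually.of_forall fun x w _ => ?_
    have h1 : HasDerivAt (fun w : ℂ => -(w * x)) (-(x : ℂ)) w := by
      exact (((hasDerivAt_id w).mul_const (x : ℂ)).neg).congr_deriv (by simp)
    exact (h1.cexp).const_mul _

theorem isOpen_re_pos : IsOpen {l : ℂ | 0 < l.re} :=
  isOpen_lt continuous_const Complex.continuous_re

theorem isPreconnected_re_pos : IsPreconnected {l : ℂ | 0 < l.re} :=
  (convex_halfSpace_re_gt 0).isPreconnected

/-- Two functions holomorphic on the right half plane that agree on a real interval are equal. -/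
theorem eqOn_re_pos_of_eqOn_Ioo {f g : ℂ → ℂ} {a b : ℝ} (ha : 0 ≤ a) (hab : a < b)
    (hf : ∀ l : ℂ, 0 < l.re → DifferentiableAt ℂ f l)
    (hg : ∀ l : ℂ, 0 < l.re → DifferentiableAt ℂ g l)
    (h : ∀ x : ℝ, x ∈ Set.Ioo a b → f x = g x) : ∀ l : ℂ, 0 < l.re → f l = g l := by
  have han : ∀ {f : ℂ → ℂ}, (∀ l : ℂ, 0 < l.re → DifferentiableAt ℂ f l) →
      AnalyticOnNhd ℂ f {l : ℂ | 0 < l.re} := fun hf =>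
    DifferentiableOn.analyticOnNhd (fun l hl => (hf l hl).differentiableWithinAt) isOpen_re_pos
  obtain ⟨c, hac, hcb⟩ := exists_between hab
  have hfreq : ∃ᶠ z in 𝓝[≠] (c : ℂ), f z = g z := by
    have ht : Filter.Tendsto (fun x : ℝ => (x : ℂ)) (𝓝[≠] c) (𝓝[≠] (c : ℂ)) := by
      refine tendsto_nhdsWithin_of_tendsto_nhds_of_eventually_within _
        (Complex.continuous_ofReal.continuousAt.tendsto.mono_left nhdsWithin_le_nhds) ?_
      filter_upwards [self_mem_nhdsWithin] with x hx
      simpa using hx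
    refine ht.frequently (Filter.Eventually.frequently ?_)
    filter_upwards [nhdsWithin_le_nhds (Ioo_mem_nhds hac hcb)] with x hx using h x hx
  exact (han hf).eqOn_of_preconnected_of_frequently_eq (han hg) isPreconnected_re_pos
    (by simpa using ha.trans_lt hac) hfreq

/-- Euler's integral along a rotated ray. -/
theorem integral_rpow_mul_cexp {s : ℝ} (hs : 0 < s) {l : ℂ} (hl : 0 < l.re) :
    ∫ x in Set.Ioi (0 : ℝ), ((x ^ (s - 1) : ℝ) : ℂ) * Complex.exp (-(l * x)) =
      l ^ (-(s : ℂ)) * Complex.Gamma s := by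
  -- Both sides are holomorphic in l, and for real l the formula is a rescaling of Euler's integral.
  -- Any interval of positive reals would do.
  refine eqOn_re_pos_of_eqOn_Ioo (f := fun l : ℂ => ∫ x in Set.Ioi (0 : ℝ),
    ((x ^ (s - 1) : ℝ) : ℂ) * Complex.exp (-(l * x)))
    (g := fun l : ℂ => l ^ (-(s : ℂ)) * Complex.Gamma s) le_rfl one_pos
    (fun l hl => differentiableAt_integral_rpow_mul_cexp hs hl)
    (fun l hl => ?_) (fun y hy => ?_) l hl
  · exact (differentiableAt_id.cpow_const (Or.inl hl)).mul_const _
  · have h := Real.integral_rpow_mul_exp_neg_mul_Ioi hs hy.1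
    have h' := congrArg (fun x : ℝ => (x : ℂ)) h
    simp only [← integral_complex_ofReal] at h'
    push_cast at h'
    rw [Complex.Gamma_ofReal]
    refine Eq.trans ?_ (h'.trans ?_)
    · rfl
    · rw [one_div, Complex.ofReal_cpow (inv_nonneg.2 hy.1.le), Complex.ofReal_inv,
        Complex.inv_cpow _ _ (by rw [Complex.arg_ofReal_of_nonneg hy.1.le]; exact Real.pi_pos.ne),
        Complex.cpow_neg]

/-- With the rate written as exp w, |Im w| < π/2, the principal power is simply exp(-sw), and no
branches have to be tracked later. -/
theorem integral_rpow_mul_cexp_exp {s : ℝ} (hs : 0 < s) {w : ℂ} (hw : |w.im| < Real.pi / 2) :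
    ∫ x in Set.Ioi (0 : ℝ), ((x ^ (s - 1) : ℝ) : ℂ) * Complex.exp (-(Complex.exp w * x)) =
      Complex.exp (-(s * w)) * Complex.Gamma s := by
  have hw' := abs_lt.1 hw
  have hre : 0 < (Complex.exp w).re := by
    rw [Complex.exp_re]
    exact mul_pos (Real.exp_pos _) (Real.cos_pos_of_mem_Ioo ⟨hw'.1, hw'.2⟩)
  rw [integral_rpow_mul_cexp hs hre, Complex.cpow_def_of_ne_zero (Complex.exp_ne_zero _),
    Complex.log_exp (by linarith [Real.pi_pos]) (by linarith [Real.pi_pos])]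
  congr 2
  ring

/-! ### The M-Wright function as an integral over a ray -/

theorem exists_mul_rpow_le_add_mul {β : ℝ} (hβ₀ : 0 < β) (hβ₁ : β < 1) {R : ℝ} (hR : 0 ≤ R)
    {b : ℝ} (hb : 0 < b) : ∃ D, ∀ x : ℝ, 0 < x → R * x ^ β ≤ D + b * x := by
  -- Beyond T, where R x^β and b x balance, the linear term dominates; below T, R x^β is at most R
  -- T^β.
  set T := (R / b) ^ (1 / (1 - β)) with hT
  have h1 : 0 < 1 - β := by linarith
  have hT0 : 0 ≤ T := by positivity
  refine ⟨R * T ^ β, fun x hx => ?_⟩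
  rcases le_total x T with h | h
  · have : R * x ^ β ≤ R * T ^ β := by gcongr
    have : 0 ≤ b * x := by positivity
    linarith
  · have h2 : R / b ≤ x ^ (1 - β) := by
      calc R / b = T ^ (1 - β) := by
            rw [hT, ← Real.rpow_mul (by positivity), one_div_mul_cancel h1.ne', Real.rpow_one]
        _ ≤ x ^ (1 - β) := Real.rpow_le_rpow hT0 h h1.le
    rw [div_le_iff₀ hb] at h2
    have h3 : R * x ^ β ≤ b * x := by
      calc R * x ^ β ≤ x ^ (1 - β) * b * x ^ β := by gcongr
        _ = b * (x ^ (1 - β) * x ^ β) := by ring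
        _ = b * x := by rw [← Real.rpow_add hx]; simp
    have : 0 ≤ R * T ^ β := by positivity
    linarith

/-- The integrand of the representation of `mWright` as an integral over the ray of argument `θ`. -/
noncomputable def wrightKernel (β θ r x : ℝ) : ℂ :=
  Complex.exp (x * Complex.exp (θ * Complex.I) -
      r * (x ^ β : ℝ) * Complex.exp (β * θ * Complex.I)) *
    (x ^ (β - 1) : ℝ) * Complex.exp (β * θ * Complex.I)

theorem measurable_wrightKernel (β θ : ℝ) :
    Measurable fun q : ℝ × ℝ => wrightKernel β θ q.1 q.2 := by
  unfold wrightKernel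
  fun_prop

theorem Complex.exp_ofReal_mul_ofReal_mul_I (β θ : ℝ) :
    (Complex.exp (β * θ * Complex.I)).re = Real.cos (β * θ) ∧
      ‖Complex.exp (β * θ * Complex.I)‖ = 1 := by
  rw [← Complex.ofReal_mul]
  exact ⟨Complex.exp_ofReal_mul_I_re _, Complex.norm_exp_ofReal_mul_I _⟩

theorem norm_wrightKernel (β θ r : ℝ) {x : ℝ} (hx : 0 < x) :
    ‖wrightKernel β θ r x‖ =
      Real.exp (x * Real.cos θ - r * x ^ β * Real.cos (β * θ)) * x ^ (β - 1) := by
  rw [wrightKernel, norm_mul, norm_mul, (Complex.exp_ofReal_mul_ofReal_mul_I β θ).2, mul_one,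
    Complex.norm_real, Real.norm_of_nonneg (Real.rpow_nonneg hx.le _), Complex.norm_exp]
  congr 2
  rw [Complex.sub_re, Complex.re_ofReal_mul, ← Complex.ofReal_mul, Complex.re_ofReal_mul,
    (Complex.exp_ofReal_mul_ofReal_mul_I β θ).1, Complex.exp_ofReal_mul_I_re]

/-- Half of the decay of exp(x cos θ) is spent on absorbing exp(R x^β), which is possible because β
< 1; the other half ensures integrability. -/
theorem integrableOn_wrightKernel_majorant {β θ : ℝ} (hβ₀ : 0 < β) (hβ₁ : β < 1)
    (hθ : Real.cos θ < 0) {R : ℝ} (hR : 0 ≤ R) :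
    MeasureTheory.IntegrableOn
      (fun x : ℝ => Real.exp (R * x ^ β) * (Real.exp (x * Real.cos θ) * x ^ (β - 1)))
      (Set.Ioi 0) := by
  obtain ⟨D, hD⟩ := exists_mul_rpow_le_add_mul hβ₀ hβ₁ hR (b := -Real.cos θ / 2) (by linarith)
  refine ((integrableOn_rpow_sub_one_mul_exp_neg_mul hβ₀ (b := -Real.cos θ / 2)
    (by linarith)).const_mul (Real.exp D)).mono'
    (by fun_prop : Measurable fun x : ℝ => Real.exp (R * x ^ β) *
      (Real.exp (x * Real.cos θ) * x ^ (β - 1))).aestronglyMeasurable ?_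
  filter_upwards [MeasureTheory.ae_restrict_mem measurableSet_Ioi] with x hx
  have hx0 : (0 : ℝ) < x := hx
  rw [Real.norm_of_nonneg (by positivity), ← mul_assoc, ← Real.exp_add,
    mul_comm (x ^ (β - 1)), ← mul_assoc, ← Real.exp_add]
  refine mul_le_mul_of_nonneg_right (Real.exp_le_exp.2 ?_) (Real.rpow_nonneg hx0.le _)
  linarith [hD x hx0]

theorem integrableOn_wrightKernel {β θ : ℝ} (hβ₀ : 0 < β) (hβ₁ : β < 1)
    (hθ : Real.cos θ < 0) (r : ℝ) :
    MeasureTheory.IntegrableOn (wrightKernel β θ r) (Set.Ioi 0) := by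
  refine (integrableOn_wrightKernel_majorant hβ₀ hβ₁ hθ (abs_nonneg r)).mono'
    ((measurable_wrightKernel β θ).comp (measurable_const.prodMk measurable_id)
      |>.aestronglyMeasurable) ?_
  filter_upwards [MeasureTheory.ae_restrict_mem measurableSet_Ioi] with x hx
  have hx0 : (0 : ℝ) < x := hx
  rw [norm_wrightKernel _ _ _ hx0, ← mul_assoc, ← Real.exp_add]
  refine mul_le_mul_of_nonneg_right (Real.exp_le_exp.2 ?_) (Real.rpow_nonneg hx0.le _)
  have h1 : -(r * x ^ β * Real.cos (β * θ)) ≤ |r * x ^ β * Real.cos (β * θ)| := neg_le_abs _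
  have h2 : |r * x ^ β * Real.cos (β * θ)| ≤ |r| * x ^ β := by
    rw [abs_mul, abs_mul, abs_of_nonneg (Real.rpow_nonneg hx0.le β)]
    exact mul_le_of_le_one_right (by positivity) (Real.abs_cos_le_one _)
  linarith

/-- `1/Γ(1 - σ)` as the imaginary part of an Euler integral over the ray of argument `θ`. -/
theorem integral_rpow_mul_cexp_ray {θ : ℝ} (hθ₀ : Real.pi / 2 < θ) (hθ₁ : θ < Real.pi) {σ : ℝ}
    (hσ : 0 < σ) :
    ∫ x in Set.Ioi (0 : ℝ), ((x ^ (σ - 1) : ℝ) : ℂ) *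
        Complex.exp (x * Complex.exp (θ * Complex.I)) * Complex.exp (σ * θ * Complex.I) =
      Complex.exp (σ * Real.pi * Complex.I) * Complex.Gamma σ := by
  -- As e^{iθ} = -e^{i(θ-π)} and |θ - π| < π/2, the rate exp(i(θ - π)) lies in the right half plane.
  have h := integral_rpow_mul_cexp_exp hσ (w := ((θ - Real.pi : ℝ) : ℂ) * Complex.I) (by
    rw [Complex.im_ofReal_mul, Complex.I_im, mul_one, abs_lt]
    constructor <;> linarith)
  have e : Complex.exp (((θ - Real.pi : ℝ) : ℂ) * Complex.I) = -Complex.exp (θ * Complex.I) := by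
    rw [Complex.ofReal_sub, sub_mul, Complex.exp_sub, Complex.exp_pi_mul_I, div_neg, div_one]
  rw [MeasureTheory.integral_mul_const]
  simp only [e, neg_mul, neg_neg] at h
  simp only [mul_comm (Complex.exp (θ * Complex.I))] at h
  rw [h, mul_right_comm, ← Complex.exp_add]
  congr 2
  push_cast
  ring

/-- The reflection formula. For a positive integer σ both sides are 0, the right one through the
convention Γ = 0 at its poles and 0⁻¹ = 0, which matches 1/Γ = 0. -/
theorem im_exp_mul_Gamma {σ : ℝ} (hσ : 0 < σ) :
    (((Complex.exp (σ * Real.pi * Complex.I) * Complex.Gamma σ).im : ℝ) : ℂ) =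
      Real.pi * (Complex.Gamma (1 - σ))⁻¹ := by
  have h := Real.Gamma_mul_Gamma_one_sub σ
  have hG := (Real.Gamma_pos_of_pos hσ).ne'
  have e1 : (Complex.exp (σ * Real.pi * Complex.I) * Complex.Gamma σ).im =
      Real.sin (Real.pi * σ) * Real.Gamma σ := by
    rw [Complex.Gamma_ofReal, Complex.im_mul_ofReal, ← Complex.ofReal_mul,
      Complex.exp_ofReal_mul_I_im, mul_comm Real.pi]
  have e2 : (Complex.Gamma (1 - σ))⁻¹ = (((Real.Gamma (1 - σ))⁻¹ : ℝ) : ℂ) := by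
    rw [Complex.ofReal_inv, ← Complex.Gamma_ofReal]; simp
  rw [e1, e2, ← Complex.ofReal_mul]
  congr 1
  have h2 : Real.Gamma (1 - σ) = Real.pi / Real.sin (Real.pi * σ) / Real.Gamma σ := by
    rw [← h]; field_simp
  rw [h2, inv_div]
  field_simp

theorem Real.hasSum_pow_div_factorial (t : ℝ) :
    HasSum (fun n : ℕ => t ^ n / (n.factorial : ℝ)) (Real.exp t) := by
  rw [Real.exp_eq_exp_ℝ]
  exact NormedSpace.expSeries_div_hasSum_exp t

theorem Complex.hasSum_pow_div_factorial (t : ℂ) :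
    HasSum (fun n : ℕ => t ^ n / (n.factorial : ℂ)) (Complex.exp t) := by
  rw [Complex.exp_eq_exp_ℂ]
  exact NormedSpace.expSeries_div_hasSum_exp t

/-- Expand exp(-r x^β e^{iβθ}) and integrate term by term: the n-th term is an Euler integral over
the ray with exponent σ = β(n + 1), whose imaginary part is π / Γ(1 - β - βn). The absolute values
sum to the majorant with R = |r|, so r may have either sign. -/
theorem hasSum_mWright {β θ : ℝ} (hβ₀ : 0 < β) (hβ₁ : β < 1) (hθ₀ : Real.pi / 2 < θ)
    (hθ₁ : θ < Real.pi) (r : ℝ) :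
    HasSum (fun n : ℕ => (-(r : ℂ)) ^ n /
        ((n.factorial : ℂ) * Complex.Gamma (-(β : ℂ) * n + 1 - β)))
      ((Real.pi⁻¹ * (∫ x in Set.Ioi (0 : ℝ), wrightKernel β θ r x).im : ℝ) : ℂ) := by
  have hcos : Real.cos θ < 0 :=
    Real.cos_neg_of_pi_div_two_lt_of_lt hθ₀ (by linarith [Real.pi_pos])
  set σ : ℕ → ℝ := fun n => β * (n + 1) with hσdef
  have hσ : ∀ n, 0 < σ n := fun n => by positivity
  set F : ℕ → ℝ → ℂ := fun n x => (-(r : ℂ)) ^ n / (n.factorial : ℂ) *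
    (((x ^ (σ n - 1) : ℝ) : ℂ) * Complex.exp (x * Complex.exp (θ * Complex.I)) *
      Complex.exp (σ n * θ * Complex.I)) with hF
  have hFint : ∀ n, ∫ x in Set.Ioi (0 : ℝ), F n x = (-(r : ℂ)) ^ n / (n.factorial : ℂ) *
      (Complex.exp (σ n * Real.pi * Complex.I) * Complex.Gamma (σ n)) := fun n => by
    rw [MeasureTheory.integral_const_mul, integral_rpow_mul_cexp_ray hθ₀ hθ₁ (hσ n)]
  have hpow : ∀ (n : ℕ) {x : ℝ}, 0 < x → x ^ (σ n - 1) = (x ^ β) ^ n * x ^ (β - 1) :=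
    fun n x hx => by
      rw [← Real.rpow_natCast, ← Real.rpow_mul hx.le, ← Real.rpow_add hx]
      congr 1; rw [hσdef]; ring
  have hterm : ∀ (n : ℕ) {x : ℝ}, 0 < x → F n x =
      (-(r * (x ^ β : ℝ) * Complex.exp (β * θ * Complex.I))) ^ n / (n.factorial : ℂ) *
        (Complex.exp (x * Complex.exp (θ * Complex.I)) * (x ^ (β - 1) : ℝ) *
          Complex.exp (β * θ * Complex.I)) := fun n x hx => by
    have e : Complex.exp (σ n * θ * Complex.I) =
        Complex.exp (β * θ * Complex.I) ^ n * Complex.exp (β * θ * Complex.I) := by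
      rw [← Complex.exp_nat_mul, ← Complex.exp_add]
      congr 1; rw [hσdef]; push_cast; ring
    simp only [hF]
    rw [hpow n hx, e, neg_pow (r : ℂ), neg_pow (_ * _), mul_pow, mul_pow]
    push_cast
    ring
  have hnorm : ∀ (n : ℕ) {x : ℝ}, 0 < x → ‖F n x‖ = (|r| * x ^ β) ^ n / (n.factorial : ℝ) *
      (Real.exp (x * Real.cos θ) * x ^ (β - 1)) := fun n x hx => by
    rw [hterm n hx, norm_mul, norm_div, norm_pow, norm_neg, norm_mul, norm_mul, norm_mul, norm_mul,
      (Complex.exp_ofReal_mul_ofReal_mul_I β θ).2, Complex.norm_real, Complex.norm_real,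
      Complex.norm_real, Real.norm_of_nonneg (Real.rpow_nonneg hx.le _),
      Real.norm_of_nonneg (Real.rpow_nonneg hx.le _), Complex.norm_exp, Complex.re_ofReal_mul,
      Complex.exp_ofReal_mul_I_re, Complex.norm_natCast, mul_one, mul_one, Real.norm_eq_abs]
  have hsum : HasSum (fun n => ∫ x in Set.Ioi (0 : ℝ), F n x)
      (∫ x in Set.Ioi (0 : ℝ), wrightKernel β θ r x) := by
    refine MeasureTheory.hasSum_integral_of_dominated_convergence
      (fun n x => (|r| * x ^ β) ^ n / (n.factorial : ℝ) *
        (Real.exp (x * Real.cos θ) * x ^ (β - 1))) (fun n => ?_) (fun n => ?_) ?_ ?_ ?_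
    · exact (by fun_prop : Measurable (F n)).aestronglyMeasurable
    · filter_upwards [MeasureTheory.ae_restrict_mem measurableSet_Ioi] with x hx
      exact (hnorm n hx).le
    · exact Filter.Eventually.of_forall fun x =>
        (Real.hasSum_pow_div_factorial _).summable.mul_right _
    · refine (integrableOn_wrightKernel_majorant hβ₀ hβ₁ hcos (abs_nonneg r)).congr ?_
      refine Filter.Eventually.of_forall fun x => ?_
      exact (((Real.hasSum_pow_div_factorial (|r| * x ^ β)).mul_right _).tsum_eq).symm
    · filter_upwards [MeasureTheory.ae_restrict_mem measurableSet_Ioi] with x hx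
      have h := (Complex.hasSum_pow_div_factorial
        (-(r * (x ^ β : ℝ) * Complex.exp (β * θ * Complex.I)))).mul_right
        (Complex.exp (x * Complex.exp (θ * Complex.I)) * (x ^ (β - 1) : ℝ) *
          Complex.exp (β * θ * Complex.I))
      have e : Complex.exp (-(r * (x ^ β : ℝ) * Complex.exp (β * θ * Complex.I))) *
          (Complex.exp (x * Complex.exp (θ * Complex.I)) * (x ^ (β - 1) : ℝ) *
          Complex.exp (β * θ * Complex.I)) = wrightKernel β θ r x := by
        rw [wrightKernel, ← mul_assoc, ← mul_assoc, ← Complex.exp_add]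
        congr 3; ring
      rw [e] at h
      exact h.congr_fun fun n => hterm n hx
  have him := ((Complex.hasSum_im hsum).mul_left Real.pi⁻¹)
  refine (Complex.hasSum_ofReal.2 him).congr_fun fun n => ?_
  have h1 := im_exp_mul_Gamma (hσ n)
  have e : (1 - (σ n : ℂ)) = -(β : ℂ) * n + 1 - β := by rw [hσdef]; push_cast; ring
  have e' : (-(r : ℂ)) ^ n / (n.factorial : ℂ) = (((-r) ^ n / (n.factorial : ℝ) : ℝ) : ℂ) := by
    push_cast; rfl
  rw [hFint, e', Complex.im_ofReal_mul, Complex.ofReal_mul, Complex.ofReal_mul, h1, e, ← e',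
    div_mul_eq_div_div, div_eq_mul_inv _ (Complex.Gamma _), Complex.ofReal_inv]
  have hpi : (Real.pi : ℂ) ≠ 0 := Complex.ofReal_ne_zero.2 Real.pi_pos.ne'
  field_simp

theorem mWright_eq_integral {β θ : ℝ} (hβ₀ : 0 < β) (hβ₁ : β < 1) (hθ₀ : Real.pi / 2 < θ)
    (hθ₁ : θ < Real.pi) (r : ℝ) :
    mWright β r =
      ((Real.pi⁻¹ * (∫ x in Set.Ioi (0 : ℝ), wrightKernel β θ r x).im : ℝ) : ℂ) :=
  (hasSum_mWright hβ₀ hβ₁ hθ₀ hθ₁ r).tsum_eq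

/-! ### Decay of the M-Wright function -/

/-- `wrightKernel` in the logarithmic variable, an entire function. -/
noncomputable def wrightLogKernel (β r : ℝ) (v : ℂ) : ℂ :=
  Complex.exp (Complex.exp v - r * Complex.exp (β * v) + β * v)

/-- The substitution x = e^v turns rays into horizontal lines and arcs into vertical segments, so
the contour can be deformed by rectangles. The Jacobian e^v combines with x^{β-1} into e^{βv}. -/
theorem exp_smul_wrightKernel (β θ r v : ℝ) :
    |Real.exp v| • wrightKernel β θ r (Real.exp v) = wrightLogKernel β r (v + θ * Complex.I) := by
  rw [abs_of_pos (Real.exp_pos v), Complex.real_smul, wrightKernel, wrightLogKernel,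
    ← Real.exp_mul, ← Real.exp_mul]
  push_cast
  have e1 : Complex.exp (v * (β - 1) : ℂ) = Complex.exp (v * β) * Complex.exp (-v) := by
    rw [← Complex.exp_add]; congr 1; ring
  have e2 : Complex.exp ((v : ℂ) + θ * Complex.I) = Complex.exp v * Complex.exp (θ * Complex.I) :=
    Complex.exp_add _ _
  have e3 : Complex.exp ((β : ℂ) * (v + θ * Complex.I)) =
      Complex.exp (v * β) * Complex.exp (β * θ * Complex.I) := by
    rw [← Complex.exp_add]; congr 1; ring
  have e4 : Complex.exp (v : ℂ) * Complex.exp (-v) = 1 := by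
    rw [← Complex.exp_add]; simp
  rw [Complex.exp_add (_ - _), e1, e2, e3, ← mul_assoc (r : ℂ)]
  linear_combination (Complex.exp (Complex.exp v * Complex.exp (θ * Complex.I) -
    r * Complex.exp (v * β) * Complex.exp (β * θ * Complex.I)) * Complex.exp (v * β) *
    Complex.exp (β * θ * Complex.I)) * e4

theorem norm_wrightLogKernel (β r x y : ℝ) :
    ‖wrightLogKernel β r (x + y * Complex.I)‖ =
      Real.exp (Real.exp x * Real.cos y - r * (Real.exp (β * x) * Real.cos (β * y)) + β * x) := by
  rw [wrightLogKernel, Complex.norm_exp]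
  congr 1
  simp [Complex.exp_re]

/-- Towards -∞ the factor e^{βv} alone provides decay, uniformly in y; the other exponents stay
bounded. -/
theorem norm_wrightLogKernel_le {β r l x : ℝ} (hβ : 0 < β) (hr : 0 ≤ r) (hx : x ≤ l) (y : ℝ) :
    ‖wrightLogKernel β r (x + y * Complex.I)‖ ≤
      Real.exp (Real.exp l + r * Real.exp (β * l)) * Real.exp (β * x) := by
  rw [norm_wrightLogKernel, ← Real.exp_add, Real.exp_le_exp]
  have h1 : Real.exp x * Real.cos y ≤ Real.exp l :=
    (mul_le_of_le_one_right (Real.exp_pos x).le (Real.cos_le_one y)).trans (Real.exp_le_exp.2 hx)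
  have h2 : -(Real.exp (β * x) * Real.cos (β * y)) ≤ Real.exp (β * l) := by
    rw [← mul_neg]
    refine (mul_le_of_le_one_right (Real.exp_pos _).le ?_).trans
      (Real.exp_le_exp.2 (mul_le_mul_of_nonneg_left hx hβ.le))
    linarith [Real.neg_one_le_cos (β * y)]
  have h3 := mul_le_mul_of_nonneg_left h2 hr
  linarith

theorem differentiable_wrightLogKernel (β r : ℝ) : Differentiable ℂ (wrightLogKernel β r) := by
  unfold wrightLogKernel
  fun_prop

theorem integrableOn_wrightLogKernel {β r : ℝ} (hβ : 0 < β) (hr : 0 ≤ r) (l y : ℝ) :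
    MeasureTheory.IntegrableOn (fun x : ℝ => wrightLogKernel β r (x + y * Complex.I))
      (Set.Iic l) := by
  refine ((integrableOn_exp_mul_Iic hβ l).const_mul
    (Real.exp (Real.exp l + r * Real.exp (β * l)))).mono' ?_ ?_
  · exact ((differentiable_wrightLogKernel β r).continuous.comp
      (by fun_prop : Continuous fun x : ℝ => (x : ℂ) + y * Complex.I)).aestronglyMeasurable
  · filter_upwards [MeasureTheory.ae_restrict_mem measurableSet_Iic] with x hx
    exact norm_wrightLogKernel_le hβ hr hx y

/-- Rotating the beginning of the ray onto the real axis, where the integrand is real, leaves an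
arc. -/
theorem im_integral_Iic_wrightLogKernel {β r θ : ℝ} (hβ : 0 < β) (hr : 0 ≤ r) (hθ : 0 ≤ θ)
    (l : ℝ) :
    (∫ x in Set.Iic l, wrightLogKernel β r (x + θ * Complex.I)).im =
      (Complex.I * ∫ y in (0 : ℝ)..θ, wrightLogKernel β r (l + y * Complex.I)).im := by
  have ha : Filter.Tendsto (fun n : ℕ => -(n : ℝ)) Filter.atTop Filter.atBot :=
    Filter.tendsto_neg_atTop_atBot.comp tendsto_natCast_atTop_atTop
  have hB : Filter.Tendsto (fun n : ℕ => Real.exp (Real.exp l + r * Real.exp (β * l)) *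
      Real.exp (β * -(n : ℝ))) Filter.atTop (𝓝 0) := by
    simpa using (Real.tendsto_exp_atBot.comp (ha.const_mul_atBot hβ)).const_mul
      (Real.exp (Real.exp l + r * Real.exp (β * l)))
  have hlim := tendsto_rectBoundaryIntegral (integrableOn_wrightLogKernel hβ hr l 0)
    (integrableOn_wrightLogKernel hβ hr l θ) ha hB hθ (by
      filter_upwards [ha.eventually (Filter.eventually_le_atBot l)] with n hn y _
      exact norm_wrightLogKernel_le hβ hr hn y)
  have h0 := tendsto_nhds_unique (hlim.congr fun n =>
    rectBoundaryIntegral_eq_zero (differentiable_wrightLogKernel β r).differentiableOn)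
    tendsto_const_nhds
  have hreal : (∫ x in Set.Iic l, wrightLogKernel β r (x + (0 : ℝ) * Complex.I)).im = 0 := by
    have e : ∀ x : ℝ, wrightLogKernel β r (x + (0 : ℝ) * Complex.I) =
        ((Real.exp (Real.exp x - r * Real.exp (β * x) + β * x) : ℝ) : ℂ) := fun x => by
      rw [wrightLogKernel]; push_cast; simp
    simp only [e]
    rw [integral_complex_ofReal, Complex.ofReal_im]
  have h1 := congrArg Complex.im h0
  rw [Complex.add_im, Complex.sub_im, hreal, Complex.zero_im] at h1
  linarith

/-- θ > π/2 makes exp(x e^{iθ}) decay along the ray, and βθ < π/2 makes exp(-r x^β e^{iβθ}) decay in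
r. The two are compatible since β < 1. -/
theorem exists_ray_angle {β : ℝ} (hβ₀ : 0 < β) (hβ₁ : β < 1) :
    ∃ θ, Real.pi / 2 < θ ∧ θ < Real.pi ∧ β * θ < Real.pi / 2 := by
  have hpi := Real.pi_pos
  have h : Real.pi / 2 < min Real.pi (Real.pi / 2 / β) := by
    refine lt_min (by linarith) ?_
    rw [lt_div_iff₀ hβ₀]
    exact mul_lt_of_lt_one_right (by linarith) hβ₁
  obtain ⟨θ, h1, h2⟩ := exists_between h
  refine ⟨θ, h1, h2.trans_le (min_le_left _ _), ?_⟩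
  have h3 := h2.trans_le (min_le_right _ _)
  rw [lt_div_iff₀ hβ₀] at h3
  linarith

/-- On the positive half line `mWright` decays faster than every exponential. -/
theorem exists_norm_mWright_le {β : ℝ} (hβ₀ : 0 < β) (hβ₁ : β < 1) {A : ℝ} (hA : 0 < A) :
    ∃ C, ∀ r : ℝ, 0 ≤ r → ‖mWright β r‖ ≤ C * Real.exp (-(A * r)) := by
  obtain ⟨θ, hθ₀, hθ₁, hθ₂⟩ := exists_ray_angle hβ₀ hβ₁
  have hpi := Real.pi_pos
  have hθ : 0 < θ := by linarith
  have hcos : Real.cos θ < 0 := Real.cos_neg_of_pi_div_two_lt_of_lt hθ₀ (by linarith)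
  set d := Real.cos (β * θ) with hd
  have hβθ : 0 < β * θ := mul_pos hβ₀ hθ
  have hd0 : 0 < d := Real.cos_pos_of_mem_Ioo ⟨by linarith, hθ₂⟩
  -- The radius e^l is chosen with d (e^l)^β = A. On the ray beyond it, r x^β cos(βθ) ≥ A r.
  set l := Real.log (A / d) / β with hl
  have hAl : d * Real.exp (β * l) = A := by
    have : β * l = Real.log (A / d) := by rw [hl]; field_simp
    rw [this, Real.exp_log (div_pos hA hd0)]; field_simp
  set D := ∫ x in Set.Ioi (0 : ℝ), x ^ (β - 1) * Real.exp (-(-Real.cos θ * x)) with hD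
  have hDi := integrableOn_rpow_sub_one_mul_exp_neg_mul hβ₀ (b := -Real.cos θ) (by linarith)
  refine ⟨Real.pi⁻¹ * (Real.exp (Real.exp l + β * l) * |θ - 0| + D), fun r hr => ?_⟩
  have hsplit : ∫ x in Set.Ioi (0 : ℝ), wrightKernel β θ r x =
      (∫ x in Set.Ioc 0 (Real.exp l), wrightKernel β θ r x) +
        ∫ x in Set.Ioi (Real.exp l), wrightKernel β θ r x := by
    have hK := integrableOn_wrightKernel hβ₀ hβ₁ hcos r
    rw [← Set.Ioc_union_Ioi_eq_Ioi (Real.exp_pos l).le]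
    exact MeasureTheory.setIntegral_union (Set.Ioc_disjoint_Ioi le_rfl) measurableSet_Ioi
      (hK.mono_set Set.Ioc_subset_Ioi_self)
      (hK.mono_set (Set.Ioi_subset_Ioi (Real.exp_pos l).le))
  have himage : Real.exp '' Set.Iic l = Set.Ioc 0 (Real.exp l) := by
    ext x
    constructor
    · rintro ⟨v, hv, rfl⟩
      exact ⟨Real.exp_pos v, Real.exp_le_exp.2 hv⟩
    · rintro ⟨h0, h1⟩
      exact ⟨Real.log x, (Real.log_le_iff_le_exp h0).2 h1, Real.exp_log h0⟩
  have hnear : ∫ x in Set.Ioc 0 (Real.exp l), wrightKernel β θ r x =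
      ∫ v in Set.Iic l, wrightLogKernel β r (v + θ * Complex.I) := by
    rw [← himage, MeasureTheory.integral_image_eq_integral_abs_deriv_smul measurableSet_Iic
      (fun v _ => (Real.hasDerivAt_exp v).hasDerivWithinAt) Real.exp_injective.injOn]
    simp only [exp_smul_wrightKernel]
  -- Near 0 the kernel on the ray has no uniform decay in r. Only the imaginary part is needed, and
  -- it equals that of an integral over the arc of radius e^l, where cos(βy) ≥ d gives the factor
  -- exp(-A r) again.
  have hnear_le : |(∫ x in Set.Ioc 0 (Real.exp l), wrightKernel β θ r x).im| ≤
      Real.exp (Real.exp l + β * l) * |θ - 0| * Real.exp (-(A * r)) := by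
    rw [hnear, im_integral_Iic_wrightLogKernel hβ₀ hr hθ.le]
    refine (Complex.abs_im_le_norm _).trans ?_
    rw [norm_mul, Complex.norm_I, one_mul, mul_right_comm]
    refine intervalIntegral.norm_integral_le_of_norm_le_const fun y hy => ?_
    rw [Set.uIoc_of_le hθ.le] at hy
    rw [norm_wrightLogKernel, ← Real.exp_add, Real.exp_le_exp]
    have h1 : Real.exp l * Real.cos y ≤ Real.exp l :=
      mul_le_of_le_one_right (Real.exp_pos l).le (Real.cos_le_one y)
    have h2 : d ≤ Real.cos (β * y) :=
      Real.cos_le_cos_of_nonneg_of_le_pi (mul_nonneg hβ₀.le hy.1.le) (by linarith)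
        (mul_le_mul_of_nonneg_left hy.2 hβ₀.le)
    have h3 : A * r ≤ r * (Real.exp (β * l) * Real.cos (β * y)) := by
      rw [← hAl, mul_comm]
      refine mul_le_mul_of_nonneg_left ?_ hr
      rw [mul_comm]
      exact mul_le_mul_of_nonneg_left h2 (Real.exp_pos _).le
    linarith
  have hfar_le : ‖∫ x in Set.Ioi (Real.exp l), wrightKernel β θ r x‖ ≤
      D * Real.exp (-(A * r)) := by
    have hsub : Set.Ioi (Real.exp l) ⊆ Set.Ioi (0 : ℝ) := Set.Ioi_subset_Ioi (Real.exp_pos l).le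
    calc ‖∫ x in Set.Ioi (Real.exp l), wrightKernel β θ r x‖
        ≤ ∫ x in Set.Ioi (Real.exp l),
            x ^ (β - 1) * Real.exp (-(-Real.cos θ * x)) * Real.exp (-(A * r)) := by
          refine MeasureTheory.norm_integral_le_of_norm_le ((hDi.mono_set hsub).mul_const _) ?_
          filter_upwards [MeasureTheory.ae_restrict_mem measurableSet_Ioi] with x hx
          have hx0 : 0 < x := hsub hx
          rw [norm_wrightKernel _ _ _ hx0, mul_comm, mul_assoc (x ^ (β - 1)),
            ← Real.exp_add]
          refine mul_le_mul_of_nonneg_left (Real.exp_le_exp.2 ?_) (Real.rpow_nonneg hx0.le _)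
          have h1 : Real.exp (β * l) ≤ x ^ β := by
            rw [mul_comm, Real.exp_mul]
            exact Real.rpow_le_rpow (Real.exp_pos l).le (le_of_lt hx) hβ₀.le
          have h2 : A * r ≤ r * x ^ β * d := by
            rw [← hAl]
            have := mul_le_mul_of_nonneg_left h1 (mul_nonneg hr hd0.le)
            linarith
          linarith
      _ ≤ D * Real.exp (-(A * r)) := by
          rw [MeasureTheory.integral_mul_const]
          refine mul_le_mul_of_nonneg_right ?_ (Real.exp_pos _).le
          refine MeasureTheory.setIntegral_mono_set hDi ?_ hsub.eventuallyLE
          filter_upwards [MeasureTheory.ae_restrict_mem measurableSet_Ioi] with x hx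
          exact mul_nonneg (Real.rpow_nonneg (le_of_lt hx) _) (Real.exp_pos _).le
  rw [mWright_eq_integral hβ₀ hβ₁ hθ₀ hθ₁, Complex.norm_real, Real.norm_eq_abs, abs_mul,
    abs_of_pos (inv_pos.2 hpi), mul_assoc, hsplit, Complex.add_im]
  refine mul_le_mul_of_nonneg_left ?_ (inv_pos.2 hpi).le
  refine (abs_add_le _ _).trans ?_
  rw [add_mul]
  exact add_le_add hnear_le ((Complex.abs_im_le_norm _).trans hfar_le)

/-! ### Continuity and moments of the M-Wright function -/

/-- A power series that converges on the positive half line is entire. -/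
theorem differentiable_tsum_of_summable {a : ℕ → ℂ}
    (ha : ∀ R : ℝ, Summable fun n => a n * (R : ℂ) ^ n) :
    Differentiable ℂ fun z : ℂ => ∑' n, a n * z ^ n := by
  intro z
  have h := (ha (‖z‖ + 1)).norm
  have hR : (0 : ℝ) ≤ ‖z‖ + 1 := by positivity
  have hd := Complex.differentiableOn_tsum_of_summable_norm (F := fun n w => a n * w ^ n)
    (U := Metric.ball 0 (‖z‖ + 1)) h (fun n => by fun_prop) Metric.isOpen_ball
    (fun n w hw => by
      rw [norm_mul, norm_mul, norm_pow, norm_pow, Complex.norm_real, Real.norm_of_nonneg hR]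
      rw [Metric.mem_ball, dist_zero_right] at hw
      gcongr)
  exact hd.differentiableAt (Metric.isOpen_ball.mem_nhds (by simp))

/-- Since `hasSum_mWright` holds at every real argument, the defining power series is entire. -/
theorem continuous_mWright {β : ℝ} (hβ₀ : 0 < β) (hβ₁ : β < 1) :
    Continuous fun r : ℝ => mWright β r := by
  obtain ⟨θ, hθ₀, hθ₁, -⟩ := exists_ray_angle hβ₀ hβ₁
  have e : ∀ (z : ℂ) (n : ℕ), (-z) ^ n /
      ((n.factorial : ℂ) * Complex.Gamma (-(β : ℂ) * n + 1 - β)) =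
      (-1) ^ n / ((n.factorial : ℂ) * Complex.Gamma (-(β : ℂ) * n + 1 - β)) * z ^ n :=
    fun z n => by rw [neg_pow]; ring
  have h := differentiable_tsum_of_summable
    (a := fun n : ℕ => (-1) ^ n / ((n.factorial : ℂ) * Complex.Gamma (-(β : ℂ) * n + 1 - β)))
    fun R => by
      have := (hasSum_mWright hβ₀ hβ₁ hθ₀ hθ₁ R).summable
      rwa [funext (e R)] at this
  have h2 : mWright β = fun z : ℂ => ∑' n : ℕ,
      (-1) ^ n / ((n.factorial : ℂ) * Complex.Gamma (-(β : ℂ) * n + 1 - β)) * z ^ n :=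
    funext fun z => tsum_congr fun n => e z n
  rw [h2]
  exact h.continuous.comp Complex.continuous_ofReal

/-- In r the kernel is an exponential of rate x^β e^{iβθ} = exp(β log x + iβθ), in the right half
plane because βθ < π/2. What remains in x is the integrand of the Euler integral over the ray with
exponent β(1 - s). -/
theorem integral_rpow_mul_wrightKernel {β θ s x : ℝ} (hθ₀ : 0 < β * θ)
    (hθ₂ : β * θ < Real.pi / 2) (hs : 0 < s) (hx : 0 < x) :
    ∫ r in Set.Ioi (0 : ℝ), ((r ^ (s - 1) : ℝ) : ℂ) * wrightKernel β θ r x =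
      Complex.Gamma s * (((x ^ (β * (1 - s) - 1) : ℝ) : ℂ) *
        Complex.exp (x * Complex.exp (θ * Complex.I)) *
        Complex.exp ((β * (1 - s) : ℝ) * θ * Complex.I)) := by
  have h := integral_rpow_mul_cexp_exp hs
    (w := ((Real.log x * β : ℝ) : ℂ) + ((β * θ : ℝ) : ℂ) * Complex.I) (by
      rw [Complex.add_im, Complex.ofReal_im, Complex.im_ofReal_mul, Complex.I_im, mul_one,
        zero_add, abs_of_pos hθ₀]
      exact hθ₂)
  have hxb : Complex.exp ((Real.log x * β : ℝ) : ℂ) = ((x ^ β : ℝ) : ℂ) := by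
    rw [Real.rpow_def_of_pos hx, Complex.ofReal_exp]
  have hxs : ((x ^ (β * (1 - s) - 1) : ℝ) : ℂ) =
      ((x ^ (β - 1) : ℝ) : ℂ) * Complex.exp (-(s * (Real.log x * β : ℝ))) := by
    rw [Real.rpow_def_of_pos hx, Real.rpow_def_of_pos hx, Complex.ofReal_exp, Complex.ofReal_exp,
      ← Complex.exp_add]
    congr 1; push_cast; ring
  have hsplit : ∀ r : ℝ, ((r ^ (s - 1) : ℝ) : ℂ) * wrightKernel β θ r x =
      ((r ^ (s - 1) : ℝ) : ℂ) * Complex.exp (-(Complex.exp (((Real.log x * β : ℝ) : ℂ) +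
        ((β * θ : ℝ) : ℂ) * Complex.I) * r)) *
      (Complex.exp (x * Complex.exp (θ * Complex.I)) * (x ^ (β - 1) : ℝ) *
        Complex.exp (β * θ * Complex.I)) := fun r => by
    rw [wrightKernel, Complex.exp_add, hxb,
      sub_eq_add_neg (_ * Complex.exp _), Complex.exp_add]
    push_cast
    ring_nf
  simp only [hsplit]
  rw [MeasureTheory.integral_mul_const, h, hxs]
  have e : Complex.exp (-(s * (((Real.log x * β : ℝ) : ℂ) + ((β * θ : ℝ) : ℂ) * Complex.I))) *
      Complex.exp (β * θ * Complex.I) = Complex.exp (-(s * (Real.log x * β : ℝ))) *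
      Complex.exp ((β * (1 - s) : ℝ) * θ * Complex.I) := by
    rw [← Complex.exp_add, ← Complex.exp_add]
    congr 1; push_cast; ring
  linear_combination (Complex.Gamma s * Complex.exp (x * Complex.exp (θ * Complex.I)) *
    (x ^ (β - 1) : ℝ)) * e

/-- Integrating the norm in r leaves a multiple of x^{β(1-s)-1} exp(x cos θ), which is integrable at
0 exactly because s < 1. -/
theorem integrable_rpow_mul_wrightKernel {β θ s : ℝ} (hβ₀ : 0 < β) (hcos : Real.cos θ < 0)
    (hd : 0 < Real.cos (β * θ)) (hs₀ : 0 < s) (hs₁ : s < 1) :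
    MeasureTheory.Integrable
      (fun q : ℝ × ℝ => ((q.1 ^ (s - 1) : ℝ) : ℂ) * wrightKernel β θ q.1 q.2)
      ((MeasureTheory.volume.restrict (Set.Ioi 0)).prod
        (MeasureTheory.volume.restrict (Set.Ioi 0))) := by
  set d := Real.cos (β * θ) with hdd
  have hm : Measurable fun q : ℝ × ℝ => ((q.1 ^ (s - 1) : ℝ) : ℂ) * wrightKernel β θ q.1 q.2 :=
    (by fun_prop : Measurable fun q : ℝ × ℝ => ((q.1 ^ (s - 1) : ℝ) : ℂ)).mul
      (measurable_wrightKernel β θ)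
  have hnorm : ∀ r x : ℝ, 0 < r → 0 < x →
      ‖((r ^ (s - 1) : ℝ) : ℂ) * wrightKernel β θ r x‖ =
        r ^ (s - 1) * Real.exp (-(x ^ β * d * r)) *
          (Real.exp (x * Real.cos θ) * x ^ (β - 1)) := fun r x hr hx => by
    rw [norm_mul, norm_wrightKernel _ _ _ hx, Complex.norm_real,
      Real.norm_of_nonneg (Real.rpow_nonneg hr.le _), sub_eq_add_neg (x * _), Real.exp_add, ← hdd]
    ring_nf
  have hbx : ∀ x : ℝ, 0 < x → 0 < x ^ β * d := fun x hx => mul_pos (Real.rpow_pos_of_pos hx _) hd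
  rw [MeasureTheory.integrable_prod_iff' hm.aestronglyMeasurable]
  constructor
  · filter_upwards [MeasureTheory.ae_restrict_mem measurableSet_Ioi] with x hx
    refine ((integrableOn_rpow_sub_one_mul_exp_neg_mul hs₀ (hbx x hx)).mul_const
      (Real.exp (x * Real.cos θ) * x ^ (β - 1))).mono'
      (hm.comp (measurable_id.prodMk measurable_const)).aestronglyMeasurable ?_
    filter_upwards [MeasureTheory.ae_restrict_mem measurableSet_Ioi] with r hr
    exact (hnorm r x hr hx).le
  · have hσ : 0 < β * (1 - s) := mul_pos hβ₀ (by linarith)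
    refine ((integrableOn_rpow_sub_one_mul_exp_neg_mul hσ (b := -Real.cos θ)
      (by linarith)).const_mul (d ^ (-s) * Real.Gamma s)).congr ?_
    filter_upwards [MeasureTheory.ae_restrict_mem measurableSet_Ioi] with x hx
    have hx0 : (0 : ℝ) < x := hx
    have h1 : ∫ r in Set.Ioi (0 : ℝ), ‖((r ^ (s - 1) : ℝ) : ℂ) * wrightKernel β θ r x‖ =
        ∫ r in Set.Ioi (0 : ℝ), r ^ (s - 1) * Real.exp (-(x ^ β * d * r)) *
          (Real.exp (x * Real.cos θ) * x ^ (β - 1)) :=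
      MeasureTheory.setIntegral_congr_fun measurableSet_Ioi fun r hr => hnorm r x hr hx
    rw [h1, MeasureTheory.integral_mul_const,
      Real.integral_rpow_mul_exp_neg_mul_Ioi hs₀ (hbx x hx), one_div,
      Real.inv_rpow (hbx x hx).le, ← Real.rpow_neg (hbx x hx).le,
      Real.mul_rpow (Real.rpow_nonneg hx0.le _) hd.le, ← Real.rpow_mul hx0.le]
    have e : x ^ (β * (1 - s) - 1) = x ^ (β * -s) * x ^ (β - 1) := by
      rw [← Real.rpow_add hx0]; congr 1; ring
    rw [e, neg_mul, neg_neg, mul_comm (Real.cos θ)]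
    ring

/-- By Fubini's theorem the r-integral gives Γ(s), and the remaining ray integral with σ = β(1 - s)
has imaginary part π / Γ(1 - β + βs). -/
theorem integral_rpow_mul_mWright_of_lt_one {β : ℝ} (hβ₀ : 0 < β) (hβ₁ : β < 1) {s : ℝ}
    (hs₀ : 0 < s) (hs₁ : s < 1) :
    ∫ r in Set.Ioi (0 : ℝ), ((r ^ (s - 1) : ℝ) : ℂ) * mWright β r =
      Complex.Gamma s * (Complex.Gamma (1 - β + β * s))⁻¹ := by
  obtain ⟨θ, hθ₀, hθ₁, hθ₂⟩ := exists_ray_angle hβ₀ hβ₁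
  have hpi := Real.pi_pos
  have hβθ : 0 < β * θ := mul_pos hβ₀ (by linarith)
  have hcos : Real.cos θ < 0 := Real.cos_neg_of_pi_div_two_lt_of_lt hθ₀ (by linarith)
  have hd : 0 < Real.cos (β * θ) := Real.cos_pos_of_mem_Ioo ⟨by linarith, hθ₂⟩
  have hσ : 0 < β * (1 - s) := mul_pos hβ₀ (by linarith)
  have hI := integrable_rpow_mul_wrightKernel hβ₀ hcos hd hs₀ hs₁
  have hswap := MeasureTheory.integral_integral_swap
    (f := fun r x : ℝ => ((r ^ (s - 1) : ℝ) : ℂ) * wrightKernel β θ r x) hI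
  have hinner : ∫ x in Set.Ioi (0 : ℝ), ∫ r in Set.Ioi (0 : ℝ),
      ((r ^ (s - 1) : ℝ) : ℂ) * wrightKernel β θ r x =
      Complex.Gamma s * (Complex.exp ((β * (1 - s) : ℝ) * Real.pi * Complex.I) *
        Complex.Gamma (β * (1 - s) : ℝ)) := by
    rw [← integral_rpow_mul_cexp_ray hθ₀ hθ₁ hσ, ← MeasureTheory.integral_const_mul]
    exact MeasureTheory.setIntegral_congr_fun measurableSet_Ioi fun x hx =>
      integral_rpow_mul_wrightKernel hβθ hθ₂ hs₀ hx
  rw [hinner] at hswap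
  have hpt : ∀ r : ℝ, ((r ^ (s - 1) : ℝ) : ℂ) * mWright β r = ((Real.pi⁻¹ *
      (∫ x in Set.Ioi (0 : ℝ), ((r ^ (s - 1) : ℝ) : ℂ) * wrightKernel β θ r x).im : ℝ) : ℂ) :=
    fun r => by
      rw [mWright_eq_integral hβ₀ hβ₁ hθ₀ hθ₁, MeasureTheory.integral_const_mul,
        Complex.im_ofReal_mul, ← Complex.ofReal_mul]
      congr 1; ring
  simp only [hpt]
  rw [integral_complex_ofReal, MeasureTheory.integral_const_mul]
  have him : ∫ r in Set.Ioi (0 : ℝ), (∫ x in Set.Ioi (0 : ℝ),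
      ((r ^ (s - 1) : ℝ) : ℂ) * wrightKernel β θ r x).im =
      (∫ r in Set.Ioi (0 : ℝ), ∫ x in Set.Ioi (0 : ℝ),
        ((r ^ (s - 1) : ℝ) : ℂ) * wrightKernel β θ r x).im :=
    Complex.imCLM.integral_comp_comm hI.integral_prod_left
  rw [him, hswap, Complex.Gamma_ofReal s, Complex.im_ofReal_mul, Complex.ofReal_mul,
    Complex.ofReal_mul, im_exp_mul_Gamma hσ, Complex.ofReal_inv]
  have hpi' : (Real.pi : ℂ) ≠ 0 := Complex.ofReal_ne_zero.2 hpi.ne'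
  have e : (1 - ((β * (1 - s) : ℝ) : ℂ)) = 1 - β + β * s := by push_cast; ring
  rw [e]
  field_simp

/-- The moments of the `M`-Wright function. -/
theorem integral_rpow_mul_mWright {β : ℝ} (hβ₀ : 0 < β) (hβ₁ : β < 1) {s : ℝ} (hs : 0 < s) :
    ∫ r in Set.Ioi (0 : ℝ), ((r ^ (s - 1) : ℝ) : ℂ) * mWright β r =
      Complex.Gamma s * (Complex.Gamma (1 - β + β * s))⁻¹ := by
  have hmellin : ∀ s : ℝ, mellin (fun r : ℝ => mWright β r) s =
      ∫ r in Set.Ioi (0 : ℝ), ((r ^ (s - 1) : ℝ) : ℂ) * mWright β r := fun s => by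
    rw [mellin]
    refine MeasureTheory.setIntegral_congr_fun measurableSet_Ioi fun r hr => ?_
    simp only [smul_eq_mul]
    rw [Complex.ofReal_cpow (le_of_lt hr)]
    push_cast
    rfl
  have hcont := continuous_mWright hβ₀ hβ₁
  obtain ⟨C, hC⟩ := exists_norm_mWright_le hβ₀ hβ₁ one_pos
  have htop : ∀ a : ℝ, (fun r : ℝ => mWright β r) =O[Filter.atTop] fun r : ℝ => r ^ (-a) := by
    intro a
    refine Asymptotics.IsBigO.trans ?_ (isLittleO_exp_neg_mul_rpow_atTop one_pos (-a)).isBigO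
    refine Asymptotics.IsBigO.of_bound C ?_
    filter_upwards [Filter.eventually_ge_atTop 0] with r hr
    rw [Real.norm_of_nonneg (Real.exp_pos _).le, neg_mul]
    exact hC r hr
  have hzero : (fun r : ℝ => mWright β r) =O[𝓝[>] 0] fun r : ℝ => r ^ (-(0 : ℝ)) := by
    simp only [neg_zero, Real.rpow_zero]
    exact (hcont.continuousAt.isBigO_one ℝ).mono nhdsWithin_le_nhds
  rw [← hmellin]
  -- The Mellin transform is holomorphic for Re s > 0 by rapid decay at ∞ and boundedness at 0, and
  -- so is the right side, as 1/Γ is entire. They agree on (0, 1).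
  refine eqOn_re_pos_of_eqOn_Ioo (f := mellin fun r : ℝ => mWright β r)
    (g := fun s : ℂ => Complex.Gamma s * (Complex.Gamma (1 - β + β * s))⁻¹) le_rfl one_pos
    (fun l hl => ?_) (fun l hl => ?_) (fun x hx => ?_) s (by simpa using hs)
  · exact mellin_differentiableAt_of_isBigO_rpow
      (hcont.locallyIntegrable.locallyIntegrableOn _) (htop (l.re + 1)) (by linarith) hzero hl
  · refine DifferentiableAt.mul (Complex.differentiableAt_Gamma _ fun m h => ?_) ?_
    · rw [h] at hl
      simp only [Complex.neg_re, Complex.natCast_re] at hl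
      linarith [(Nat.cast_nonneg m : (0 : ℝ) ≤ m)]
    · exact DifferentiableAt.comp l (f := fun s : ℂ => 1 - (β : ℂ) + β * s)
        (Complex.differentiable_one_div_Gamma _) (by fun_prop)
  · rw [hmellin, integral_rpow_mul_mWright_of_lt_one hβ₀ hβ₁ hx.1 hx.2]

/-! ### The Laplace transform and the conclusion -/

theorem integrableOn_mWright_majorant {β ρ : ℝ} (hβ₀ : 0 < β) (hβ₁ : β < 1) (hρ : 0 < ρ)
    {R : ℝ} (hR : 0 ≤ R) :
    MeasureTheory.IntegrableOn
      (fun r : ℝ => Real.exp (r * R) * (‖mWright β r‖ * r ^ (ρ - 1))) (Set.Ioi 0) := by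
  -- The rate R + 1 outweighs exp(rR) and leaves exp(-r).
  obtain ⟨C, hC⟩ := exists_norm_mWright_le hβ₀ hβ₁ (A := R + 1) (by linarith)
  refine ((integrableOn_rpow_sub_one_mul_exp_neg_mul hρ one_pos).const_mul C).mono' ?_ ?_
  · exact ((by fun_prop : Measurable fun r : ℝ => Real.exp (r * R)).mul
      ((continuous_mWright hβ₀ hβ₁).norm.measurable.mul
        (by fun_prop : Measurable fun r : ℝ => r ^ (ρ - 1)))).aestronglyMeasurable
  · filter_upwards [MeasureTheory.ae_restrict_mem measurableSet_Ioi] with r hr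
    have hr0 : (0 : ℝ) < r := hr
    rw [Real.norm_of_nonneg (by positivity)]
    calc Real.exp (r * R) * (‖mWright β r‖ * r ^ (ρ - 1))
        ≤ Real.exp (r * R) * (C * Real.exp (-((R + 1) * r)) * r ^ (ρ - 1)) := by
          gcongr
          exact hC r hr0.le
      _ = C * (r ^ (ρ - 1) * (Real.exp (r * R) * Real.exp (-((R + 1) * r)))) := by ring
      _ = C * (r ^ (ρ - 1) * Real.exp (-(1 * r))) := by
          rw [← Real.exp_add]; ring_nf

theorem integrableOn_mWright_laplace {β ρ : ℝ} (hβ₀ : 0 < β) (hβ₁ : β < 1) (hρ : 0 < ρ) (z : ℂ) :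
    MeasureTheory.IntegrableOn
      (fun r : ℝ => mWright β r * ((r ^ (ρ - 1) : ℝ) : ℂ) * Complex.exp (-(r : ℂ) * z))
      (Set.Ioi 0) := by
  refine (integrableOn_mWright_majorant hβ₀ hβ₁ hρ (norm_nonneg z)).mono' ?_ ?_
  · exact (((continuous_mWright hβ₀ hβ₁).measurable.mul
      (by fun_prop : Measurable fun r : ℝ => ((r ^ (ρ - 1) : ℝ) : ℂ))).mul
      (by fun_prop : Measurable fun r : ℝ => Complex.exp (-(r : ℂ) * z))).aestronglyMeasurable
  · filter_upwards [MeasureTheory.ae_restrict_mem measurableSet_Ioi] with r hr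
    have hr0 : (0 : ℝ) < r := hr
    rw [norm_mul, norm_mul, Complex.norm_real,
      Real.norm_of_nonneg (Real.rpow_nonneg hr0.le _), mul_comm]
    refine mul_le_mul_of_nonneg_right ?_ (by positivity)
    rw [Complex.norm_exp, Real.exp_le_exp]
    refine (Complex.re_le_norm _).trans ?_
    rw [norm_mul, norm_neg, Complex.norm_real, Real.norm_of_nonneg hr0.le]

/-- The Laplace transform of `mWright β r * r ^ (ρ - 1)` as a power series. -/
theorem hasSum_laplaceFoxTerm {β ρ : ℝ} (hβ₀ : 0 < β) (hβ₁ : β < 1) (hρ : 0 < ρ) (z : ℂ) :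
    HasSum (laplaceFoxTerm β ρ z) (∫ r in Set.Ioi (0 : ℝ),
      mWright β r * ((r ^ (ρ - 1) : ℝ) : ℂ) * Complex.exp (-(r : ℂ) * z)) := by
  have hcont := continuous_mWright hβ₀ hβ₁
  have hsum : HasSum (fun k : ℕ => ∫ r in Set.Ioi (0 : ℝ),
      mWright β r * ((r ^ (ρ - 1) : ℝ) : ℂ) * ((-(r : ℂ) * z) ^ k / (k.factorial : ℂ)))
      (∫ r in Set.Ioi (0 : ℝ),
        mWright β r * ((r ^ (ρ - 1) : ℝ) : ℂ) * Complex.exp (-(r : ℂ) * z)) := by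
    refine MeasureTheory.hasSum_integral_of_dominated_convergence
      (fun k r => (r * ‖z‖) ^ k / (k.factorial : ℝ) * (‖mWright β r‖ * r ^ (ρ - 1)))
      (fun k => ?_) (fun k => ?_) ?_ ?_ ?_
    · exact ((hcont.measurable.mul
        (by fun_prop : Measurable fun r : ℝ => ((r ^ (ρ - 1) : ℝ) : ℂ))).mul
        (by fun_prop : Measurable fun r : ℝ =>
          (-(r : ℂ) * z) ^ k / (k.factorial : ℂ))).aestronglyMeasurable
    · filter_upwards [MeasureTheory.ae_restrict_mem measurableSet_Ioi] with r hr
      have hr0 : (0 : ℝ) < r := hr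
      rw [norm_mul, norm_mul, norm_div, norm_pow, norm_mul, norm_neg, Complex.norm_real,
        Complex.norm_real, Real.norm_of_nonneg hr0.le,
        Real.norm_of_nonneg (Real.rpow_nonneg hr0.le _), Complex.norm_natCast, mul_comm]
    · exact Filter.Eventually.of_forall fun r =>
        (Real.hasSum_pow_div_factorial _).summable.mul_right _
    · refine (integrableOn_mWright_majorant hβ₀ hβ₁ hρ (norm_nonneg z)).congr ?_
      exact Filter.Eventually.of_forall fun r =>
        (((Real.hasSum_pow_div_factorial (r * ‖z‖)).mul_right _).tsum_eq).symm
    · exact Filter.Eventually.of_forall fun r => (Complex.hasSum_pow_div_factorial _).mul_left _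
  refine hsum.congr_fun fun k => ?_
  have hk : 0 < ρ + k := by positivity
  -- The k-th term is, up to a constant, the moment with s = ρ + k, which exceeds 1 for large k;
  -- this is why the moments are needed beyond s < 1.
  have h1 : ∫ r in Set.Ioi (0 : ℝ),
      mWright β r * ((r ^ (ρ - 1) : ℝ) : ℂ) * ((-(r : ℂ) * z) ^ k / (k.factorial : ℂ)) =
      ∫ r in Set.Ioi (0 : ℝ), (-z) ^ k / (k.factorial : ℂ) *
        (((r ^ (ρ + k - 1) : ℝ) : ℂ) * mWright β r) := by
    refine MeasureTheory.setIntegral_congr_fun measurableSet_Ioi fun r hr => ?_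
    have e : r ^ (ρ + k - 1) = r ^ (ρ - 1) * r ^ k := by
      rw [← Real.rpow_natCast, ← Real.rpow_add hr]; congr 1; ring
    simp only [e]
    push_cast
    rw [neg_mul, ← mul_neg, mul_pow]
    ring
  rw [h1, MeasureTheory.integral_const_mul, integral_rpow_mul_mWright hβ₀ hβ₁ hk, laplaceFoxTerm]
  push_cast
  rw [div_eq_mul_inv, div_eq_mul_inv, mul_inv, mul_add, ← add_assoc]
  ring

/-- The residue series is entire in z, so its sum is itself the holomorphic extension to z = 0. -/
theorem laplaceFoxParams_hasFoxH_of_summable {β ρ : ℝ} (hβ : 0 < β) (hρ : 0 < ρ)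
    (hs : ∀ z, Summable (laplaceFoxTerm β ρ z)) (z : ℂ) :
    (laplaceFoxParams β ρ).HasFoxH z (∑' k, laplaceFoxTerm β ρ z k) := by
  refine ⟨laplaceFoxParams_valid hβ ρ, ?_⟩
  rcases eq_or_ne z 0 with rfl | hz
  · refine Or.inr ⟨rfl, fun u => ∑' k, laplaceFoxTerm β ρ u k, ?_, rfl, ?_⟩
    · have e : ∀ (u : ℂ) (k : ℕ), laplaceFoxTerm β ρ u k =
          ((-1) ^ k * Complex.Gamma ((ρ : ℂ) + k) /
            ((k.factorial : ℂ) * Complex.Gamma (1 - (β : ℂ) + β * ρ + β * k))) * u ^ k :=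
        fun u k => by rw [laplaceFoxTerm, neg_pow]; ring
      have h := differentiable_tsum_of_summable (a := fun k : ℕ =>
        ((-1) ^ k * Complex.Gamma ((ρ : ℂ) + k) /
            ((k.factorial : ℂ) * Complex.Gamma (1 - (β : ℂ) + β * ρ + β * k))))
        fun R => by
          have := hs R
          rwa [funext (e R)] at this
      simp only [e]
      exact h.analyticAt 0
    · filter_upwards [self_mem_nhdsWithin] with u hu
      exact laplaceFoxParams_hasContourValue hβ hρ hu (hs u).hasSum
  · exact Or.inl ⟨hz, laplaceFoxParams_hasContourValue hβ hρ hz (hs z).hasSum⟩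

theorem mainTheorem10 (β : ℝ) (hβ₀ : 0 < β) (hβ₁ : β < 1) :
    (∀ ρ : ℝ, 1 / 2 ≤ ρ → ∀ z : ℂ,
      MeasureTheory.IntegrableOn
        (fun r : ℝ => mWright β r * ((r ^ (ρ - 1) : ℝ) : ℂ) * Complex.exp (-(r : ℂ) * z))
        (Set.Ioi 0) ∧
      (laplaceFoxParams β ρ).HasFoxH z ((laplaceFoxParams β ρ).foxH z) ∧
      (∫ r in Set.Ioi (0 : ℝ),
          mWright β r * ((r ^ (ρ - 1) : ℝ) : ℂ) * Complex.exp (-(r : ℂ) * z)) =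
        (laplaceFoxParams β ρ).foxH z ∧
      HasSum
        (fun k : ℕ => (-z) ^ k * Complex.Gamma ((ρ : ℂ) + k) /
          ((k.factorial : ℂ) * Complex.Gamma (1 - (β : ℂ) + β * ρ + β * k)))
        ((laplaceFoxParams β ρ).foxH z)) ∧
    (∀ z : ℂ,
      MeasureTheory.IntegrableOn
        (fun r : ℝ => mWright β r * Complex.exp (-(r : ℂ) * z)) (Set.Ioi 0) ∧
      (∫ r in Set.Ioi (0 : ℝ), mWright β r * Complex.exp (-(r : ℂ) * z)) =
        mittagLeffler β (-z)) := by
  have main : ∀ ρ : ℝ, 0 < ρ → ∀ z : ℂ, (laplaceFoxParams β ρ).HasFoxH z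
      (∫ r in Set.Ioi (0 : ℝ),
        mWright β r * ((r ^ (ρ - 1) : ℝ) : ℂ) * Complex.exp (-(r : ℂ) * z)) := by
    intro ρ hρ z
    have h := hasSum_laplaceFoxTerm hβ₀ hβ₁ hρ
    rw [← (h z).tsum_eq]
    exact laplaceFoxParams_hasFoxH_of_summable hβ₀ hρ (fun u => (h u).summable) z
  refine ⟨fun ρ hρ' z => ?_, fun z => ?_⟩
  · have hρ : 0 < ρ := by linarith
    have hH := main ρ hρ z
    refine ⟨integrableOn_mWright_laplace hβ₀ hβ₁ hρ z, ?_, hH.foxH_eq.symm, ?_⟩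
    · rw [hH.foxH_eq]; exact hH
    · rw [hH.foxH_eq]; exact hasSum_laplaceFoxTerm hβ₀ hβ₁ hρ z
  -- This is the case ρ = 1: the power of r disappears and Γ(1 + k) cancels k!, leaving the
  -- Mittag-Leffler series at -z.
  · have hi := integrableOn_mWright_laplace hβ₀ hβ₁ one_pos z
    have hs := (hasSum_laplaceFoxTerm hβ₀ hβ₁ one_pos z).tsum_eq
    simp only [sub_self, Real.rpow_zero, Complex.ofReal_one, mul_one] at hi hs
    refine ⟨hi, ?_⟩
    rw [← hs, mittagLeffler]
    refine tsum_congr fun k => ?_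
    have hk : (k.factorial : ℂ) ≠ 0 := Nat.cast_ne_zero.2 k.factorial_ne_zero
    have e1 : Complex.Gamma (((1 : ℝ) : ℂ) + k) = k.factorial := by
      rw [Complex.ofReal_one, add_comm, Complex.Gamma_nat_eq_factorial]
    have e2 : (1 - (β : ℂ) + β * ((1 : ℝ) : ℂ) + β * k) = β * k + 1 := by
      rw [Complex.ofReal_one]; ring
    rw [laplaceFoxTerm, e1, e2, mul_comm, mul_div_mul_left _ _ hk]
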